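/- Let $r \ge 1$ and $\alpha_1,\dots,\alpha_r \in [0,1)$. The multiple Hurwitz zeta function of depth $r$ is the meromorphic continuation to $\mathbb{C}^r$ of $$\zeta_r(s_1,\dots,s_r;\alpha_1,\dots,\alpha_r)=\sum_{n_1>\cdots>n_r>0}\frac{1}{(n_1+\alpha_1)^{s_1}\cdots(n_r+\alpha_r)^{s_r}},$$ where the series converges absolutely on $\{\Re(s_1+\cdots+s_i)>i \text{ for all } 1\le i\le r\}$; the function of depth $0$ is the constant $1$. For $1\le i\le r$ and $k\ge 0$ let $H_{i,k}=\{s\in\mathbb{C}^r : s_1+\cdots+s_i=i-k\}$; the residue of a meromorphic function $F$ along $H_{i,k}$ is the restriction to $H_{i,k}$ of the meromorphic function $(s_1+\cdots+s_i-i+k)\,F(s)$. For a real number $\beta$ let $\mathbf{B}(\beta;t)$ be the infinite upper triangular matrix with rows and columns indexed by the integers $m,n\ge 0$ whose $(m,m)$ entry is $\frac{1}{t+m}$, whose $(m,n)$ entry for $m<n$ is $$(t+m+1)(t+m+2)\cdots(t+n-1)\,\frac{B_{n-m}(\beta)}{(n-m)!},$$ and whose $(m,n)$ entry for $m>n$ is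 $0$; here $B_j$ are the Bernoulli polynomials, $\frac{xe^{\beta x}}{e^x-1}=\sum_{j\ge0}B_j(\beta)\frac{x^j}{j!}$. Then this meromorphic continuation exists, and the following holds. (1) The residue of $\zeta_r(s_1,\dots,s_r;\alpha_1,\dots,\alpha_r)$ along $H_{1,0}$ exists and is the restriction to $H_{1,0}$ of $\zeta_{r-1}(s_2,\dots,s_r;\alpha_2,\dots,\alpha_r)$. (2) For all $2\le i\le r$ and $k\ge 0$, the residue of $\zeta_r(s_1,\dots,s_r;\alpha_1,\dots,\alpha_r)$ along $H_{i,k}$ exists and is the restriction to $H_{i,k}$ of the product of $\zeta_{r-i}(s_{i+1},\dots,s_r;\alpha_{i+1},\dots,\alpha_r)$ with the $(0,k)$ entry of the matrix $$\prod_{d=1}^{i-1}\mathbf{B}(\alpha_{d+1}-\alpha_d;\,s_1+\cdots+s_d-d),$$ the factors being multiplied in the order $d=1,2,\dots,i-1$ from left to right. -/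

import Mathlib

open Filter Topology

noncomputable section

namespace MHZ

/-! ### Meromorphic functions on `ℂⁿ`

A meromorphic function is represented by a total function, whose values on the zero set of a local
denominator carry no information. -/

/-- `F` and `G` define the same germ of a meromorphic function at `p`: they agree near `p` off the
zero set of some nonzero germ of a holomorphic function. -/
def MeroEqAt {n : ℕ} (F G : (Fin n → ℂ) → ℂ) (p : Fin n → ℂ) : Prop :=
  ∃ h : (Fin n → ℂ) → ℂ, AnalyticAt ℂ h p ∧ (∃ᶠ s in 𝓝 p, h s ≠ 0) ∧
    ∀ᶠ s in 𝓝 p, h s ≠ 0 → F s = G s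

/-- `F` is a meromorphic function on `ℂⁿ`: near every point it is the quotient of two holomorphic
functions, the denominator not being identically zero. -/
def IsMeromorphic {n : ℕ} (F : (Fin n → ℂ) → ℂ) : Prop :=
  ∀ p : Fin n → ℂ, ∃ g h : (Fin n → ℂ) → ℂ, AnalyticAt ℂ g p ∧ AnalyticAt ℂ h p ∧
    (∃ᶠ s in 𝓝 p, h s ≠ 0) ∧ ∀ᶠ s in 𝓝 p, h s ≠ 0 → F s = g s / h s

/-- The meromorphic function `F` is holomorphic at `p` (after removing removable singularities),
and its value there is `v`. -/
def HasValueAt {n : ℕ} (F : (Fin n → ℂ) → ℂ) (p : Fin n → ℂ) (v : ℂ) : Prop :=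
  ∃ g : (Fin n → ℂ) → ℂ, AnalyticAt ℂ g p ∧ MeroEqAt F g p ∧ g p = v

/-- The meromorphic function `F` can be restricted to the hyperplane `H`: the points of `H` at
which `F` is holomorphic are dense in `H`, that is, `H` is not a polar hyperplane of `F`. -/
def RestrictsTo {n : ℕ} (F : (Fin n → ℂ) → ℂ) (H : Set (Fin n → ℂ)) : Prop :=
  H ⊆ closure {p | p ∈ H ∧ ∃ v, HasValueAt F p v}

/-- The restrictions of `F` and `G` to the hyperplane `H` exist and are the same meromorphic
function on `H`. -/
def SameRestriction {n : ℕ} (F G : (Fin n → ℂ) → ℂ) (H : Set (Fin n → ℂ)) : Prop :=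
  RestrictsTo F H ∧ RestrictsTo G H ∧
    ∀ p ∈ H, ∀ v w : ℂ, HasValueAt F p v → HasValueAt G p w → v = w

/-! ### The multiple Hurwitz zeta function -/

/-- `s₁ + ⋯ + sₘ` -/
def partialSum {r : ℕ} (s : Fin r → ℂ) (m : ℕ) : ℂ :=
  ∑ j ∈ Finset.univ.filter (fun j : Fin r => j.val < m), s j

/-- `(s_{i+1}, …, s_r)` -/
def dropFirst {X : Type*} {r : ℕ} (i : ℕ) (s : Fin r → X) : Fin (r - i) → X :=
  fun j => s ⟨i + j, by omega⟩

/-- The domain of convergence `U_r`. -/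
def convergenceDomain (r : ℕ) : Set (Fin r → ℂ) :=
  {s | ∀ i : ℕ, 1 ≤ i → i ≤ r → (i : ℝ) < (partialSum s i).re}

/-- The index set `n₁ > ⋯ > n_r > 0` of the series. -/
abbrev Index (r : ℕ) : Type := {n : Fin r → ℕ // StrictAnti n ∧ ∀ j, 0 < n j}

/-- The general term of the multiple Hurwitz zeta series. -/
def zetaTerm {r : ℕ} (α : Fin r → ℝ) (s : Fin r → ℂ) (n : Index r) : ℂ :=
  1 / ∏ j : Fin r, ((n.1 j : ℂ) + (α j : ℂ)) ^ (s j)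

/-- `F` is a meromorphic function on `ℂʳ` which is the sum of the multiple Hurwitz zeta series
on `U_r`. -/
def IsMeromorphicContinuation {r : ℕ} (α : Fin r → ℝ) (F : (Fin r → ℂ) → ℂ) : Prop :=
  IsMeromorphic F ∧ ∀ s ∈ convergenceDomain r, HasSum (zetaTerm α s) (F s)

open Classical in
/-- The multiple Hurwitz zeta function `ζ_r(s₁, …, s_r; α₁, …, α_r)` on `ℂʳ`: the meromorphic
continuation of its series (`0` if there were none). In depth `0` it is `1`. -/
def zeta {r : ℕ} (α : Fin r → ℝ) : (Fin r → ℂ) → ℂ :=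
  if h : ∃ F, IsMeromorphicContinuation α F then h.choose else 0

/-- The linear form `s₁ + ⋯ + s_i - i + k`. -/
def linForm (r i k : ℕ) (s : Fin r → ℂ) : ℂ :=
  partialSum s i - i + k

/-- The hyperplane `H_{i,k}`. -/
def hyperplane (r i k : ℕ) : Set (Fin r → ℂ) :=
  {s | partialSum s i = i - k}

/-- The residue of `F` along `H_{i,k}`, that is, the restriction of `(s₁ + ⋯ + s_i - i + k) F`
to `H_{i,k}`, exists and is the restriction of the meromorphic function `R` to `H_{i,k}`. -/
def ResidueEq {r : ℕ} (i k : ℕ) (F R : (Fin r → ℂ) → ℂ) : Prop :=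
  SameRestriction (fun s => linForm r i k s * F s) R (hyperplane r i k)

/-! ### The infinite triangular matrices

The incidence algebra of `ℕ` is the ring of upper triangular matrices of type `ℕ × ℕ`. -/

/-- The matrix `B(β; t)`: its `(m, m)` entry is `1 / (t + m)`, and for `m < n` its `(m, n)` entry is
`(t + m + 1) ⋯ (t + n - 1) B_{n-m}(β) / (n - m)!`. -/
def bernoulliMatrix (β : ℝ) (t : ℂ) : IncidenceAlgebra ℂ ℕ where
  toFun m n :=
    if n < m then 0
    else if n = m then 1 / (t + m)
    else (∏ j ∈ Finset.Ioo m n, (t + j)) *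
      ((Polynomial.aeval β (Polynomial.bernoulli (n - m)) : ℝ) : ℂ) / (n - m).factorial
  eq_zero_of_not_le' m n h := by
    rw [if_pos (not_le.mp h)]

/-- The product of `B(α_{d+1} - α_d; s₁ + ⋯ + s_d - d)` over `d = 1, …, i - 1`, in this order
from left to right (`d` is `e + 1` below). -/
def residueMatrix {r : ℕ} (α : Fin r → ℝ) (i : ℕ) (hi : i ≤ r) (s : Fin r → ℂ) :
    IncidenceAlgebra ℂ ℕ :=
  (List.ofFn fun e : Fin (i - 1) =>
    bernoulliMatrix (α ⟨e + 1, by omega⟩ - α ⟨e, by omega⟩)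
      (partialSum s (e + 1) - ((e : ℕ) + 1 : ℂ))).prod

end MHZ

end

/-!
The sum over the largest index `n₁` is replaced by its Euler–Maclaurin expansion. With `t = s₁ - 1`,
`b = α₂ - α₁` and `x = n₂ + α₂` one has, for every `K`,
`t * ∑_{n₁ > n₂} (n₁ + α₁) ^ (-t - 1) = ∑_{j ≤ K} c_j(t) x ^ (-t - j) + ∑_m E_K(t, x + m)`,
where `c_j(t) = t (t + 1) ⋯ (t + j - 1) B_j(b) / j!` and the defect `E_K(t, x)` is entire in `t`,
vanishes at `t = 0`, and is `O(x ^ (-Re t - K - 1))` locally uniformly in `t`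
(`exists_norm_tailDefect_le`, `hasSum_tail`). Summing over the other indices gives
`(s₁ - 1) ζ_r(s) = ∑_{j ≤ K} c_j(s₁ - 1) ζ_{r-1}(s₁ + s₂ - 1 + j, s₃, …) + (remainder)`,
in which the remainder is holomorphic where `Re (s₁ + ⋯ + s_i) > i - K` for all `i`
(`hasSum_zetaTerm_succ`, `analyticAt_remainder`). As these domains exhaust `ℂʳ`, induction on `r`
gives the meromorphic continuation (`isMeromorphicContinuation_zeta_of_mem_Ico`), and by the
identity theorem the formula persists for it (`meroEqAt_zeta_peeled`). The same formula and
induction show that `ζ_r` is holomorphic off the hyperplanes `H_{i,k}` (`exists_hasValueAt_zeta`).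

The coefficient `c_j(s₁ - 1)` is `s₁ - 1` times the `(0, j)` entry of `B(α₂ - α₁; s₁ - 1)`. The map
`s ↦ (s₁ + s₂ - 1 + j, s₃, …)` carries `H_{i,k}` to `H_{i-1,k-j}`, and it translates the parameters
of the remaining matrices by `j`, which deletes their first `j` rows and columns
(`bernoulliMatrix_add`). So the recursion for the residues is the expansion of the matrix product
along its first factor (`residueMatrix_succ`), with the residue along `s₁ = 1` as the base case
(`hasValueAt_linForm_mul_zeta`). Residues are computed at the points of `H_{i,k}` lying on no
`H_{i',k'}` with `i' ≠ i`; these are dense in `H_{i,k}` (`hyperplane_subset_closure`), and values of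
holomorphic functions are continuous (`SameRestriction.of_dense`).

A tool on which this rests is that a normally convergent series of holomorphic functions of several
variables is holomorphic (`analyticAt_tsum_of_ball`). It follows from Cauchy's estimates for all
derivatives.
-/

noncomputable section

namespace MHZ

/-! ### Normally convergent series of holomorphic functions of several variables -/

section NormalConvergence

variable {E : Type*} [NormedAddCommGroup E] [NormedSpace ℂ E]

/-- Cauchy's estimate for the first derivative, on a smaller concentric ball. -/
theorem norm_fderiv_le_of_forall_ball {G : Type*} [NormedAddCommGroup G] [NormedSpace ℂ G]
    {f : E → G} {c x : E} {R ρ M : ℝ} (hρ : 0 < ρ) (hx : x ∈ Metric.ball c (R - ρ))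
    (hf : DifferentiableOn ℂ f (Metric.ball c R)) (hM : ∀ z ∈ Metric.ball c R, ‖f z‖ ≤ M) :
    ‖fderiv ℂ f x‖ ≤ 2 / ρ * M := by
  have hsub : Metric.ball x ρ ⊆ Metric.ball c R := by
    apply Metric.ball_subset_ball'
    have := Metric.mem_ball.1 hx
    linarith
  have h := Complex.norm_fderiv_le_div_of_mapsTo_ball (R₂ := 2 * M) (hf.mono hsub) ?_ hρ
  · calc _ ≤ _ := h
      _ = _ := by ring
  · intro z hz
    rw [mem_closedBall_iff_norm]
    calc ‖f z - f x‖ ≤ ‖f z‖ + ‖f x‖ := norm_sub_le _ _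
      _ ≤ M + M := add_le_add (hM _ (hsub hz)) (hM _ (hsub (Metric.mem_ball_self hρ)))
      _ = _ := by ring

theorem norm_iteratedFDeriv_le_of_forall_ball {f : E → ℂ} {c : E} {R ρ M : ℝ} (hρ : 0 < ρ)
    (hf : AnalyticOnNhd ℂ f (Metric.ball c R)) (hM : ∀ z ∈ Metric.ball c R, ‖f z‖ ≤ M) (k : ℕ) :
    ∀ x ∈ Metric.ball c (R - k * ρ), ‖iteratedFDeriv ℂ k f x‖ ≤ (2 / ρ) ^ k * M := by
  induction k with
  | zero => intro x hx; simpa using hM x (by simpa using hx)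
  | succ k ih =>
    intro x hx
    rw [← norm_fderiv_iteratedFDeriv, pow_succ', mul_assoc]
    refine norm_fderiv_le_of_forall_ball (R := R - k * ρ) hρ ?_ ?_ ih
    · convert! hx using 2
      push_cast; ring
    · refine (hf.iteratedFDeriv k).differentiableOn.mono (Metric.ball_subset_ball ?_)
      have : 0 ≤ k * ρ := by positivity
      linarith

/-- Cauchy's estimates for the Taylor coefficients, with a constant that suffices for
convergence questions. -/
theorem norm_iteratedFDeriv_div_factorial_le {f : E → ℂ} {c : E} {R M : ℝ} (hR : 0 < R)
    (hf : AnalyticOnNhd ℂ f (Metric.ball c R)) (hM : ∀ z ∈ Metric.ball c R, ‖f z‖ ≤ M) (k : ℕ) :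
    ‖((k.factorial : ℂ)⁻¹ • iteratedFDeriv ℂ k f c)‖ ≤
      Real.exp 1 * M * (2 * Real.exp 1 / R) ^ k := by
  have hM0 : 0 ≤ M := (norm_nonneg _).trans (hM c (Metric.mem_ball_self hR))
  have h := norm_iteratedFDeriv_le_of_forall_ball (ρ := R / (k + 1)) (by positivity) hf hM k c
    (by
      apply Metric.mem_ball_self
      have : k * (R / (k + 1)) = R - R / (k + 1) := by field_simp; ring
      rw [this]
      have : 0 < R / (k + 1) := by positivity
      linarith)
  rw [norm_smul, norm_inv, Complex.norm_natCast]
  -- `(k + 1) ^ k / k! ≤ exp (k + 1)` absorbs the loss from shrinking the ball `k` times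
  have h2 : ((k + 1 : ℝ)) ^ k / k.factorial ≤ Real.exp 1 * Real.exp 1 ^ k := by
    have := Real.pow_div_factorial_le_exp (k + 1 : ℝ) (by positivity) (k + 1)
    calc ((k + 1 : ℝ)) ^ k / k.factorial = (k + 1 : ℝ) ^ (k + 1) / (k + 1).factorial := by
          rw [Nat.factorial_succ, pow_succ']; push_cast; field_simp
      _ ≤ Real.exp (k + 1) := this
      _ = Real.exp 1 * Real.exp 1 ^ k := by
        rw [← Real.exp_nat_mul, ← Real.exp_add]; congr 1; ring
  calc _ ≤ (k.factorial : ℝ)⁻¹ * ((2 / (R / (k + 1))) ^ k * M) := by gcongr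
    _ = ((k + 1 : ℝ) ^ k / k.factorial) * ((2 / R) ^ k * M) := by
      rw [show 2 / (R / ((k : ℝ) + 1)) = (k + 1) * (2 / R) by field_simp, mul_pow]; ring
    _ ≤ (Real.exp 1 * Real.exp 1 ^ k) * ((2 / R) ^ k * M) := by gcongr
    _ = _ := by
      rw [show 2 * Real.exp 1 / R = Real.exp 1 * (2 / R) by ring, mul_pow]; ring

/-- The Taylor series of `f` at `c`. -/
def taylorFMS (f : E → ℂ) (c : E) : FormalMultilinearSeries ℂ E ℂ :=
  fun k => (k.factorial : ℂ)⁻¹ • iteratedFDeriv ℂ k f c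

/-- A bounded holomorphic function on a ball is the sum of its Taylor series on a ball whose radius
depends only on the radius of the given one. -/
theorem hasSum_taylorFMS {f : E → ℂ} {c : E} {R M : ℝ} (hR : 0 < R)
    (hf : AnalyticOnNhd ℂ f (Metric.ball c R)) (hM : ∀ z ∈ Metric.ball c R, ‖f z‖ ≤ M)
    {h : E} (hh : ‖h‖ < R / (2 * Real.exp 1)) :
    HasSum (fun k => taylorFMS f c k (fun _ => h)) (f (c + h)) := by
  set δ : ℝ := R / (2 * Real.exp 1) with hδ
  have hδ0 : 0 < δ := by positivity
  have hδR : δ ≤ R := by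
    rw [hδ, div_le_iff₀ (by positivity)]
    nlinarith [Real.add_one_le_exp (1 : ℝ)]
  lift δ to NNReal using hδ0.le with d hd
  have hd0 : (0 : ENNReal) < d := by exact_mod_cast hδ0
  have hrad : (d : ENNReal) ≤ (taylorFMS f c).radius := by
    refine FormalMultilinearSeries.le_radius_of_bound _ (Real.exp 1 * M) fun k => ?_
    calc _ ≤ Real.exp 1 * M * (2 * Real.exp 1 / R) ^ k * (d : ℝ) ^ k := by
          gcongr
          exact norm_iteratedFDeriv_div_factorial_le hR hf hM k
      _ = Real.exp 1 * M := by
        rw [mul_assoc, ← mul_pow, hδ]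
        field_simp
        simp
  have hp := ((taylorFMS f c).hasFPowerSeriesOnBall (hd0.trans_le hrad)).mono hd0 hrad
  obtain ⟨p, ρ, hfp⟩ := hf c (Metric.mem_ball_self hR)
  -- both sides are analytic on the ball and agree near its centre
  have hEq : Set.EqOn (fun z => (taylorFMS f c).sum (z - c)) f (Metric.eball c d) := by
    have h1 := (hp.comp_sub c)
    rw [zero_add] at h1
    refine h1.analyticOnNhd.eqOn_of_preconnected_of_eventuallyEq (z₀ := c) ?_ ?_
      (Metric.mem_eball_self hd0) ?_
    · refine hf.mono ?_
      rw [Metric.eball_coe]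
      exact Metric.ball_subset_ball hδR
    · rw [Metric.eball_coe]
      exact (convex_ball (E := E) c d |>.isPreconnected)
    · filter_upwards [Metric.eball_mem_nhds c hfp.r_pos] with z hz
      have := hfp.hasSum_iteratedFDeriv (y := z - c)
        (by simpa [edist_eq_enorm_sub] using hz)
      rw [add_sub_cancel] at this
      exact this.tsum_eq
  have hmem : c + h ∈ Metric.eball c d := by
    rw [Metric.eball_coe]; simpa using hh
  have := hEq hmem
  simp only [add_sub_cancel_left] at this
  rw [← this]
  have h3 := hp.hasSum (y := h) (by rw [Metric.eball_coe]; simpa using hh)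
  simpa using h3

/-- A series of holomorphic functions on a ball which is dominated by a convergent series of
constants has a holomorphic sum. -/
theorem analyticAt_tsum_of_ball [CompleteSpace E] {ι : Type*} {f : ι → E → ℂ} {c : E} {R : ℝ}
    (hR : 0 < R) {M : ι → ℝ} (hMs : Summable M)
    (hf : ∀ m, AnalyticOnNhd ℂ (f m) (Metric.ball c R))
    (hM : ∀ m, ∀ z ∈ Metric.ball c R, ‖f m z‖ ≤ M m) :
    AnalyticAt ℂ (fun z => ∑' m, f m z) c := by
  set e := Real.exp 1
  have he : 0 < e := Real.exp_pos 1
  have hM0 : ∀ m, 0 ≤ M m := fun m =>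
    (norm_nonneg _).trans (hM m c (Metric.mem_ball_self hR))
  let p : FormalMultilinearSeries ℂ E ℂ := fun k => ∑' m, taylorFMS (f m) c k
  have hbd : ∀ k m, ‖taylorFMS (f m) c k‖ ≤ e * M m * (2 * e / R) ^ k := fun k m =>
    norm_iteratedFDeriv_div_factorial_le hR (hf m) (hM m) k
  have hsumk : ∀ k, Summable fun m => taylorFMS (f m) c k := fun k =>
    Summable.of_norm_bounded ((hMs.mul_left e).mul_right _) (hbd k)
  set δ : ℝ := R / (4 * e) with hδ
  have hδ0 : 0 < δ := by positivity
  have hδ' : 2 * e / R * δ = 1 / 2 := by rw [hδ]; field_simp; norm_num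
  have hle : δ < R / (2 * e) := by
    rw [hδ]; gcongr; norm_num
  lift δ to NNReal using hδ0.le with d hd
  have hd0 : (0 : ENNReal) < d := by exact_mod_cast hδ0
  refine ⟨p, d, ?_, hd0, ?_⟩
  · refine FormalMultilinearSeries.le_radius_of_bound _ (e * ∑' m, M m) fun k => ?_
    have h1 : ‖p k‖ ≤ e * (∑' m, M m) * (2 * e / R) ^ k := by
      have h2 : HasSum (fun m => e * M m * (2 * e / R) ^ k)
          (e * (∑' m, M m) * (2 * e / R) ^ k) := (hMs.hasSum.mul_left e).mul_right _
      exact tsum_of_norm_bounded h2 (hbd k)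
    calc _ ≤ e * (∑' m, M m) * (2 * e / R) ^ k * (d : ℝ) ^ k := by gcongr
      _ = e * (∑' m, M m) * (1 / 2) ^ k := by rw [mul_assoc, ← mul_pow, hδ']
      _ ≤ e * (∑' m, M m) * 1 := by
        have : 0 ≤ ∑' m, M m := tsum_nonneg hM0
        gcongr
        exact pow_le_one₀ (by norm_num) (by norm_num)
      _ = _ := mul_one _
  · intro h hh
    have hh : ‖h‖ < d := by rw [Metric.eball_coe] at hh; simpa using hh
    have hlt : ‖h‖ < R / (2 * e) := hh.trans hle
    have hbd2 : ∀ x : ι × ℕ, ‖taylorFMS (f x.1) c x.2 (fun _ => h)‖ ≤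
        (e * M x.1) * (1 / 2) ^ x.2 := by
      rintro ⟨m, k⟩
      calc ‖taylorFMS (f m) c k (fun _ => h)‖ ≤ ‖taylorFMS (f m) c k‖ * ∏ _i : Fin k, ‖h‖ :=
            ContinuousMultilinearMap.le_opNorm _ _
        _ ≤ (e * M m * (2 * e / R) ^ k) * (d : ℝ) ^ k := by
          rw [Finset.prod_const, Finset.card_univ, Fintype.card_fin]
          have := hM0 m
          gcongr
          exact hbd k m
        _ = _ := by rw [mul_assoc, ← mul_pow, hδ']
    have hS : Summable fun x : ι × ℕ => taylorFMS (f x.1) c x.2 (fun _ => h) := by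
      refine Summable.of_norm_bounded ?_ hbd2
      exact (hMs.mul_left e).mul_of_nonneg
        (summable_geometric_of_lt_one (by norm_num) (by norm_num))
        (fun m => mul_nonneg he.le (hM0 m)) (fun k => by positivity)
    have h1 : HasSum (fun m => f m (c + h))
        (∑' x : ι × ℕ, taylorFMS (f x.1) c x.2 (fun _ => h)) :=
      hS.hasSum.prod_fiberwise fun m => hasSum_taylorFMS hR (hf m) (hM m) hlt
    have hS' : HasSum (fun x : ℕ × ι => taylorFMS (f x.2) c x.1 (fun _ => h))
        (∑' x : ι × ℕ, taylorFMS (f x.1) c x.2 (fun _ => h)) :=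
      (Equiv.prodComm ℕ ι).hasSum_iff.2 hS.hasSum
    rw [h1.tsum_eq]
    refine hS'.prod_fiberwise fun k => ?_
    exact ContinuousMultilinearMap.hasSum_eval (hsumk k).hasSum (fun _ => h)

end NormalConvergence

/-! ### Germs of meromorphic functions -/

section Germs

variable {n : ℕ}

/-- The germ of `h` at `p` is that of a holomorphic function which is not identically zero. -/
def NonzeroGerm (h : (Fin n → ℂ) → ℂ) (p : Fin n → ℂ) : Prop :=
  AnalyticAt ℂ h p ∧ ∃ᶠ s in 𝓝 p, h s ≠ 0

/-- `F` is a quotient of holomorphic functions near `p`. -/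
def IsMeromorphicAt (F : (Fin n → ℂ) → ℂ) (p : Fin n → ℂ) : Prop :=
  ∃ g h : (Fin n → ℂ) → ℂ, AnalyticAt ℂ g p ∧ AnalyticAt ℂ h p ∧
    (∃ᶠ s in 𝓝 p, h s ≠ 0) ∧ ∀ᶠ s in 𝓝 p, h s ≠ 0 → F s = g s / h s

theorem NonzeroGerm.one (p : Fin n → ℂ) : NonzeroGerm (fun _ => 1) p :=
  ⟨analyticAt_const, Frequently.of_forall fun _ => one_ne_zero⟩

theorem AnalyticAt.exists_ball_analyticOnNhd {h : (Fin n → ℂ) → ℂ} {p : Fin n → ℂ}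
    (hh : AnalyticAt ℂ h p) : ∃ ε > 0, AnalyticOnNhd ℂ h (Metric.ball p ε) := by
  obtain ⟨ε, hε, hb⟩ := Metric.eventually_nhds_iff_ball.1 hh.eventually_analyticAt
  exact ⟨ε, hε, hb⟩

/-- On a ball where `h` is holomorphic, vanishing near one point means vanishing everywhere. -/
theorem eqOn_zero_ball {h : (Fin n → ℂ) → ℂ} {p q : Fin n → ℂ} {ε : ℝ}
    (hh : AnalyticOnNhd ℂ h (Metric.ball p ε)) (hq : q ∈ Metric.ball p ε)
    (h0 : ∀ᶠ s in 𝓝 q, h s = 0) : ∀ s ∈ Metric.ball p ε, h s = 0 := fun _ hs =>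
  hh.eqOn_zero_of_preconnected_of_eventuallyEq_zero (convex_ball p ε).isPreconnected hq h0 hs

theorem NonzeroGerm.eventually {h : (Fin n → ℂ) → ℂ} {p : Fin n → ℂ} (hh : NonzeroGerm h p) :
    ∀ᶠ q in 𝓝 p, NonzeroGerm h q := by
  obtain ⟨ε, hε, hb⟩ := AnalyticAt.exists_ball_analyticOnNhd hh.1
  filter_upwards [Metric.ball_mem_nhds p hε] with q hq
  refine ⟨hb q hq, fun h0 => hh.2 ?_⟩
  filter_upwards [Metric.ball_mem_nhds p hε] with s hs
  simpa using eqOn_zero_ball hb hq (by simpa using h0) s hs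

/-- A holomorphic germ is zero if its product with a nonzero germ is. -/
theorem NonzeroGerm.eventually_eq_zero {h g : (Fin n → ℂ) → ℂ} {p : Fin n → ℂ}
    (hh : NonzeroGerm h p) (hg : AnalyticAt ℂ g p) (h0 : ∀ᶠ s in 𝓝 p, h s ≠ 0 → g s = 0) :
    ∀ᶠ s in 𝓝 p, g s = 0 := by
  obtain ⟨ε, hε, hb⟩ := AnalyticAt.exists_ball_analyticOnNhd hg
  have h1 := hh.2.and_eventually
    (((show ∀ᶠ q in 𝓝 p, q ∈ Metric.ball p ε from Metric.ball_mem_nhds p hε).and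
      hh.1.eventually_analyticAt).and
      (eventually_eventually_nhds.2 h0))
  obtain ⟨q, hq, ⟨hqb, hqa⟩, hq0⟩ := h1.exists
  filter_upwards [Metric.ball_mem_nhds p hε] with s hs
  refine eqOn_zero_ball hb hqb ?_ s hs
  filter_upwards [hq0, hqa.continuousAt.eventually_ne hq] with s h1 h2 using h1 h2

theorem NonzeroGerm.mul {h g : (Fin n → ℂ) → ℂ} {p : Fin n → ℂ}
    (hh : NonzeroGerm h p) (hg : NonzeroGerm g p) : NonzeroGerm (fun s => h s * g s) p := by
  refine ⟨hh.1.mul hg.1, fun h0 => hg.2 ?_⟩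
  simpa using hh.eventually_eq_zero hg.1
    (h0.mono fun s hs h1 => by simpa [h1] using hs)

/-- Nonzero germs pull back to nonzero germs along a holomorphic map with a local section. -/
theorem NonzeroGerm.comp {m : ℕ} {h : (Fin m → ℂ) → ℂ} {A : (Fin n → ℂ) → (Fin m → ℂ)}
    {σ : (Fin m → ℂ) → (Fin n → ℂ)} {p : Fin n → ℂ} (hh : NonzeroGerm h (A p))
    (hA : AnalyticAt ℂ A p) (hσ : ContinuousAt σ (A p)) (hσp : σ (A p) = p)
    (hAσ : ∀ u, A (σ u) = u) : NonzeroGerm (fun s => h (A s)) p := by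
  refine ⟨hh.1.comp hA, ?_⟩
  have ht : Tendsto σ (𝓝 (A p)) (𝓝 p) := by
    have h1 := hσ.tendsto
    rwa [hσp] at h1
  refine ht.frequently (hh.2.mono fun u hu => ?_)
  simpa only [hAσ] using hu

theorem MeroEqAt.of_eventuallyEq {F G : (Fin n → ℂ) → ℂ} {p : Fin n → ℂ} (h : F =ᶠ[𝓝 p] G) :
    MeroEqAt F G p :=
  ⟨fun _ => 1, analyticAt_const, (NonzeroGerm.one p).2, h.mono fun _ hs _ => hs⟩

theorem MeroEqAt.refl (F : (Fin n → ℂ) → ℂ) (p : Fin n → ℂ) : MeroEqAt F F p :=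
  .of_eventuallyEq (EventuallyEq.refl _ _)

theorem MeroEqAt.symm {F G : (Fin n → ℂ) → ℂ} {p : Fin n → ℂ} (h : MeroEqAt F G p) :
    MeroEqAt G F p := by
  obtain ⟨k, hk, hk0, hFG⟩ := h
  exact ⟨k, hk, hk0, hFG.mono fun s hs h0 => (hs h0).symm⟩

theorem MeroEqAt.map₂ {F G F' G' : (Fin n → ℂ) → ℂ} {p : Fin n → ℂ} (h : MeroEqAt F G p)
    (h' : MeroEqAt F' G' p) (op : ℂ → ℂ → ℂ) :
    MeroEqAt (fun s => op (F s) (F' s)) (fun s => op (G s) (G' s)) p := by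
  obtain ⟨k, hk, hk0, hFG⟩ := h
  obtain ⟨k', hk', hk0', hFG'⟩ := h'
  have hm := NonzeroGerm.mul ⟨hk, hk0⟩ ⟨hk', hk0'⟩
  refine ⟨_, hm.1, hm.2, ?_⟩
  filter_upwards [hFG, hFG'] with s h1 h2 h0
  rw [h1 (left_ne_zero_of_mul h0), h2 (right_ne_zero_of_mul h0)]

theorem MeroEqAt.trans {F G H : (Fin n → ℂ) → ℂ} {p : Fin n → ℂ} (h : MeroEqAt F G p)
    (h' : MeroEqAt G H p) : MeroEqAt F H p := by
  obtain ⟨k, hk, hk0, hFG⟩ := h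
  obtain ⟨k', hk', hk0', hFG'⟩ := h'
  have hm := NonzeroGerm.mul ⟨hk, hk0⟩ ⟨hk', hk0'⟩
  refine ⟨_, hm.1, hm.2, ?_⟩
  filter_upwards [hFG, hFG'] with s h1 h2 h0
  rw [h1 (left_ne_zero_of_mul h0), h2 (right_ne_zero_of_mul h0)]

theorem MeroEqAt.add {F G F' G' : (Fin n → ℂ) → ℂ} {p : Fin n → ℂ} (h : MeroEqAt F G p)
    (h' : MeroEqAt F' G' p) : MeroEqAt (fun s => F s + F' s) (fun s => G s + G' s) p :=
  h.map₂ h' (· + ·)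

theorem MeroEqAt.mul {F G F' G' : (Fin n → ℂ) → ℂ} {p : Fin n → ℂ} (h : MeroEqAt F G p)
    (h' : MeroEqAt F' G' p) : MeroEqAt (fun s => F s * F' s) (fun s => G s * G' s) p :=
  h.map₂ h' (· * ·)

theorem MeroEqAt.comp {m : ℕ} {F G : (Fin m → ℂ) → ℂ} {A : (Fin n → ℂ) → (Fin m → ℂ)}
    {σ : (Fin m → ℂ) → (Fin n → ℂ)} {p : Fin n → ℂ} (h : MeroEqAt F G (A p))
    (hA : AnalyticAt ℂ A p) (hσ : ContinuousAt σ (A p)) (hσp : σ (A p) = p)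
    (hAσ : ∀ u, A (σ u) = u) : MeroEqAt (fun s => F (A s)) (fun s => G (A s)) p := by
  obtain ⟨k, hk, hk0, hFG⟩ := h
  have hm := NonzeroGerm.comp ⟨hk, hk0⟩ hA hσ hσp hAσ
  exact ⟨_, hm.1, hm.2, hA.continuousAt.eventually hFG⟩

theorem MeroEqAt.eventually {F G : (Fin n → ℂ) → ℂ} {p : Fin n → ℂ} (h : MeroEqAt F G p) :
    ∀ᶠ q in 𝓝 p, MeroEqAt F G q := by
  obtain ⟨k, hk, hk0, hFG⟩ := h
  filter_upwards [NonzeroGerm.eventually ⟨hk, hk0⟩, eventually_eventually_nhds.2 hFG] with q h1 h2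
  exact ⟨k, h1.1, h1.2, h2⟩

theorem AnalyticAt.isMeromorphicAt {g : (Fin n → ℂ) → ℂ} {p : Fin n → ℂ}
    (hg : AnalyticAt ℂ g p) : IsMeromorphicAt g p :=
  ⟨g, fun _ => 1, hg, analyticAt_const, (NonzeroGerm.one p).2, .of_forall fun s _ => by simp⟩

theorem IsMeromorphicAt.add {F G : (Fin n → ℂ) → ℂ} {p : Fin n → ℂ} (hF : IsMeromorphicAt F p)
    (hG : IsMeromorphicAt G p) : IsMeromorphicAt (fun s => F s + G s) p := by
  obtain ⟨g, h, hg, hh, hh0, hFe⟩ := hF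
  obtain ⟨g', h', hg', hh', hh0', hGe⟩ := hG
  have hm := NonzeroGerm.mul ⟨hh, hh0⟩ ⟨hh', hh0'⟩
  refine ⟨fun s => g s * h' s + h s * g' s, _, (hg.mul hh').add (hh.mul hg'), hm.1, hm.2, ?_⟩
  filter_upwards [hFe, hGe] with s h1 h2 h0
  rw [h1 (left_ne_zero_of_mul h0), h2 (right_ne_zero_of_mul h0),
    div_add_div _ _ (left_ne_zero_of_mul h0) (right_ne_zero_of_mul h0)]

theorem IsMeromorphicAt.mul {F G : (Fin n → ℂ) → ℂ} {p : Fin n → ℂ} (hF : IsMeromorphicAt F p)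
    (hG : IsMeromorphicAt G p) : IsMeromorphicAt (fun s => F s * G s) p := by
  obtain ⟨g, h, hg, hh, hh0, hFe⟩ := hF
  obtain ⟨g', h', hg', hh', hh0', hGe⟩ := hG
  have hm := NonzeroGerm.mul ⟨hh, hh0⟩ ⟨hh', hh0'⟩
  refine ⟨fun s => g s * g' s, _, hg.mul hg', hm.1, hm.2, ?_⟩
  filter_upwards [hFe, hGe] with s h1 h2 h0
  rw [h1 (left_ne_zero_of_mul h0), h2 (right_ne_zero_of_mul h0), div_mul_div_comm]

theorem IsMeromorphicAt.div_nonzeroGerm {F k : (Fin n → ℂ) → ℂ} {p : Fin n → ℂ}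
    (hF : IsMeromorphicAt F p) (hk : NonzeroGerm k p) :
    IsMeromorphicAt (fun s => F s / k s) p := by
  obtain ⟨g, h, hg, hh, hh0, hFe⟩ := hF
  have hm := NonzeroGerm.mul ⟨hh, hh0⟩ hk
  refine ⟨g, _, hg, hm.1, hm.2, ?_⟩
  filter_upwards [hFe] with s h1 h0
  rw [h1 (left_ne_zero_of_mul h0), div_div]

theorem IsMeromorphicAt.sum {ι : Type*} {t : Finset ι} {F : ι → (Fin n → ℂ) → ℂ} {p : Fin n → ℂ}
    (hF : ∀ i ∈ t, IsMeromorphicAt (F i) p) : IsMeromorphicAt (fun s => ∑ i ∈ t, F i s) p := by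
  classical
  induction t using Finset.induction_on with
  | empty => simpa using AnalyticAt.isMeromorphicAt (analyticAt_const (v := (0 : ℂ)))
  | insert a t ha ih =>
    simp only [Finset.sum_insert ha]
    exact (hF a (Finset.mem_insert_self _ _)).add
      (ih fun i hi => hF i (Finset.mem_insert_of_mem hi))

theorem IsMeromorphicAt.comp {m : ℕ} {F : (Fin m → ℂ) → ℂ} {A : (Fin n → ℂ) → (Fin m → ℂ)}
    {σ : (Fin m → ℂ) → (Fin n → ℂ)} {p : Fin n → ℂ} (hF : IsMeromorphicAt F (A p))
    (hA : AnalyticAt ℂ A p) (hσ : ContinuousAt σ (A p)) (hσp : σ (A p) = p)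
    (hAσ : ∀ u, A (σ u) = u) : IsMeromorphicAt (fun s => F (A s)) p := by
  obtain ⟨g, h, hg, hh, hh0, hFe⟩ := hF
  have hm := NonzeroGerm.comp ⟨hh, hh0⟩ hA hσ hσp hAσ
  exact ⟨fun s => g (A s), _, hg.comp hA, hm.1, hm.2, hA.continuousAt.eventually hFe⟩

/-- The identity theorem for meromorphic functions on a connected set. -/
theorem MeroEqAt.of_isPreconnected {F G : (Fin n → ℂ) → ℂ} {U : Set (Fin n → ℂ)}
    (hU : IsPreconnected U) (hF : ∀ p ∈ U, IsMeromorphicAt F p)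
    (hG : ∀ p ∈ U, IsMeromorphicAt G p) {p₀ : Fin n → ℂ} (hp₀ : p₀ ∈ U)
    (h₀ : MeroEqAt F G p₀) : ∀ p ∈ U, MeroEqAt F G p := by
  refine hU.subset_of_closure_inter_subset (u := {p | MeroEqAt F G p}) ?_ ⟨p₀, hp₀, h₀⟩ ?_
  · exact isOpen_iff_mem_nhds.2 fun p hp => hp.eventually
  · rintro p ⟨hpc, hpU⟩
    obtain ⟨g, h, hg, hh, hh0, hFe⟩ := hF p hpU
    obtain ⟨g', h', hg', hh', hh0', hGe⟩ := hG p hpU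
    have hm := NonzeroGerm.mul ⟨hh, hh0⟩ ⟨hh', hh0'⟩
    have hd : AnalyticAt ℂ (fun s => g s * h' s - g' s * h s) p := (hg.mul hh').sub (hg'.mul hh)
    obtain ⟨ε, hε, hb⟩ := AnalyticAt.exists_ball_analyticOnNhd hd
    obtain ⟨q, hqFG, hqb, hqm, hqF, hqG⟩ := ((mem_closure_iff_frequently.1 hpc).and_eventually
      ((show ∀ᶠ q in 𝓝 p, q ∈ Metric.ball p ε from Metric.ball_mem_nhds p hε).and
        (hm.eventually.and ((eventually_eventually_nhds.2 hFe).and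
          (eventually_eventually_nhds.2 hGe))))).exists
    obtain ⟨k, hk, hk0, hFG⟩ := hqFG
    have h0 := eqOn_zero_ball hb hqb ((NonzeroGerm.mul ⟨hk, hk0⟩ hqm).eventually_eq_zero
      (hb q hqb) (by
        filter_upwards [hqF, hqG, hFG] with s h1 h2 h3 h4
        have h5 := right_ne_zero_of_mul h4
        have h6 := h3 (left_ne_zero_of_mul h4)
        rw [h1 (left_ne_zero_of_mul h5), h2 (right_ne_zero_of_mul h5),
          div_eq_div_iff (left_ne_zero_of_mul h5) (right_ne_zero_of_mul h5)] at h6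
        exact sub_eq_zero.2 h6))
    refine ⟨_, hm.1, hm.2, ?_⟩
    filter_upwards [hFe, hGe, Metric.ball_mem_nhds p hε] with s h1 h2 h3 h4
    rw [h1 (left_ne_zero_of_mul h4), h2 (right_ne_zero_of_mul h4),
      div_eq_div_iff (left_ne_zero_of_mul h4) (right_ne_zero_of_mul h4)]
    exact sub_eq_zero.1 (h0 s h3)

end Germs

/-! ### Values of meromorphic functions -/

section Values

variable {n : ℕ}

theorem HasValueAt.of_analyticAt {g : (Fin n → ℂ) → ℂ} {p : Fin n → ℂ} (hg : AnalyticAt ℂ g p) :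
    HasValueAt g p (g p) :=
  ⟨g, hg, .refl g p, rfl⟩

theorem HasValueAt.const (c : ℂ) (p : Fin n → ℂ) : HasValueAt (fun _ => c) p c :=
  .of_analyticAt analyticAt_const

theorem HasValueAt.congr {F G : (Fin n → ℂ) → ℂ} {p : Fin n → ℂ} {v : ℂ} (h : HasValueAt F p v)
    (hFG : MeroEqAt G F p) : HasValueAt G p v := by
  obtain ⟨g, hg, hFg, hv⟩ := h
  exact ⟨g, hg, hFG.trans hFg, hv⟩

theorem HasValueAt.unique {F : (Fin n → ℂ) → ℂ} {p : Fin n → ℂ} {v w : ℂ} (h : HasValueAt F p v)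
    (h' : HasValueAt F p w) : v = w := by
  obtain ⟨g, hg, hFg, rfl⟩ := h
  obtain ⟨g', hg', hFg', rfl⟩ := h'
  obtain ⟨k, hk, hk0, he⟩ := hFg.symm.trans hFg'
  have := NonzeroGerm.eventually_eq_zero ⟨hk, hk0⟩ (hg.sub hg')
    (he.mono fun s h1 h2 => by simp [h1 h2])
  exact sub_eq_zero.1 this.self_of_nhds

theorem HasValueAt.add {F G : (Fin n → ℂ) → ℂ} {p : Fin n → ℂ} {v w : ℂ} (h : HasValueAt F p v)
    (h' : HasValueAt G p w) : HasValueAt (fun s => F s + G s) p (v + w) := by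
  obtain ⟨g, hg, hFg, rfl⟩ := h
  obtain ⟨g', hg', hFg', rfl⟩ := h'
  exact ⟨fun s => g s + g' s, hg.add hg', hFg.add hFg', rfl⟩

theorem HasValueAt.mul {F G : (Fin n → ℂ) → ℂ} {p : Fin n → ℂ} {v w : ℂ} (h : HasValueAt F p v)
    (h' : HasValueAt G p w) : HasValueAt (fun s => F s * G s) p (v * w) := by
  obtain ⟨g, hg, hFg, rfl⟩ := h
  obtain ⟨g', hg', hFg', rfl⟩ := h'
  exact ⟨fun s => g s * g' s, hg.mul hg', hFg.mul hFg', rfl⟩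

theorem HasValueAt.sum {ι : Type*} {t : Finset ι} {F : ι → (Fin n → ℂ) → ℂ} {p : Fin n → ℂ}
    {v : ι → ℂ} (hF : ∀ i ∈ t, HasValueAt (F i) p (v i)) :
    HasValueAt (fun s => ∑ i ∈ t, F i s) p (∑ i ∈ t, v i) := by
  classical
  induction t using Finset.induction_on with
  | empty => simpa using HasValueAt.const 0 p
  | insert a t ha ih =>
    simp only [Finset.sum_insert ha]
    exact (hF a (Finset.mem_insert_self _ _)).add
      (ih fun i hi => hF i (Finset.mem_insert_of_mem hi))

theorem HasValueAt.comp {m : ℕ} {F : (Fin m → ℂ) → ℂ} {A : (Fin n → ℂ) → (Fin m → ℂ)}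
    {σ : (Fin m → ℂ) → (Fin n → ℂ)} {p : Fin n → ℂ} {v : ℂ} (hF : HasValueAt F (A p) v)
    (hA : AnalyticAt ℂ A p) (hσ : ContinuousAt σ (A p)) (hσp : σ (A p) = p)
    (hAσ : ∀ u, A (σ u) = u) : HasValueAt (fun s => F (A s)) p v := by
  obtain ⟨g, hg, hFg, rfl⟩ := hF
  exact ⟨fun s => g (A s), hg.comp hA, hFg.comp hA hσ hσp hAσ, rfl⟩

/-- The values of two meromorphic functions on a hyperplane are compared on a dense subset, as they
depend continuously on the point. -/
theorem SameRestriction.of_dense {F G : (Fin n → ℂ) → ℂ} {H D : Set (Fin n → ℂ)} (hDH : D ⊆ H)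
    (hD : H ⊆ closure D) (h : ∀ p ∈ D, ∃ v, HasValueAt F p v ∧ HasValueAt G p v) :
    SameRestriction F G H := by
  refine ⟨fun p hp => closure_mono ?_ (hD hp), fun p hp => closure_mono ?_ (hD hp), ?_⟩
  · exact fun q hq => ⟨hDH hq, (h q hq).imp fun v hv => hv.1⟩
  · exact fun q hq => ⟨hDH hq, (h q hq).imp fun v hv => hv.2⟩
  · rintro p hp v w ⟨f, hf, hFf, rfl⟩ ⟨g, hg, hGg, rfl⟩
    have hfreq : ∃ᶠ q in 𝓝 p, f q - g q = 0 := by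
      refine ((mem_closure_iff_frequently.1 (hD hp)).and_eventually ((hFf.eventually.and
        hGg.eventually).and (hf.eventually_analyticAt.and hg.eventually_analyticAt))).mono ?_
      rintro q ⟨hqD, ⟨h1, h2⟩, h3, h4⟩
      obtain ⟨v, hv, hv'⟩ := h q hqD
      have e1 := (hv.congr h1.symm).unique (.of_analyticAt h3)
      have e2 := (hv'.congr h2.symm).unique (.of_analyticAt h4)
      rw [← e1, ← e2, sub_self]
    by_contra hne
    have hc : ContinuousAt (fun q => f q - g q) p := (hf.sub hg).continuousAt
    exact hfreq (hc.eventually_ne (sub_ne_zero.2 hne))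

/-- Meromorphic functions on an open cover which agree on the overlaps are the restrictions of one
function, which also takes their values wherever they are holomorphic. -/
theorem exists_glued {F : ℕ → (Fin n → ℂ) → ℂ} {D : ℕ → Set (Fin n → ℂ)}
    (hopen : ∀ K, IsOpen (D K)) (hcover : ∀ p, ∃ K, p ∈ D K)
    (hF : ∀ K, ∀ p ∈ D K, IsMeromorphicAt (F K) p)
    (hcompat : ∀ K K', ∀ p ∈ D K, p ∈ D K' → MeroEqAt (F K) (F K') p) :
    ∃ G : (Fin n → ℂ) → ℂ, IsMeromorphic G ∧
      ∀ K, ∀ p ∈ D K, ∀ v, HasValueAt (F K) p v → G p = v := by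
  classical
  let good : (Fin n → ℂ) → ℂ → Prop := fun p v => ∃ K, p ∈ D K ∧ HasValueAt (F K) p v
  let G : (Fin n → ℂ) → ℂ := fun p => if h : ∃ v, good p v then h.choose else 0
  have hG : ∀ K, ∀ p ∈ D K, ∀ v, HasValueAt (F K) p v → G p = v := by
    intro K p hp v hv
    have hex : ∃ v, good p v := ⟨v, K, hp, hv⟩
    obtain ⟨K', hp', hv'⟩ := hex.choose_spec
    simp only [G, dif_pos hex]
    exact hv'.unique (hv.congr (hcompat K' K p hp' hp))
  refine ⟨G, fun p => ?_, hG⟩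
  obtain ⟨K, hK⟩ := hcover p
  obtain ⟨g, h, hg, hh, hh0, hFe⟩ := hF K p hK
  refine ⟨g, h, hg, hh, hh0, ?_⟩
  filter_upwards [(hopen K).mem_nhds hK, hg.eventually_analyticAt, hh.eventually_analyticAt,
    eventually_eventually_nhds.2 hFe] with s hsK hga hha hs h0
  refine hG K s hsK _ ((HasValueAt.of_analyticAt (hga.div hha h0)).congr (.of_eventuallyEq ?_))
  filter_upwards [hs, hha.continuousAt.eventually_ne h0] with z h1 h2 using h1 h2

end Values

/-! ### The Euler–Maclaurin expansion of a Hurwitz tail -/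

section EulerMaclaurin

/-- The rising factorial `t (t + 1) ⋯ (t + j - 1)`. -/
def rising (t : ℂ) (j : ℕ) : ℂ := ∏ l ∈ Finset.range j, (t + l)

/-- `B_j(b) / j!`, as a complex number. -/
def bernoulliCoeff (b : ℝ) (j : ℕ) : ℂ :=
  ((Polynomial.aeval b (Polynomial.bernoulli j) : ℝ) : ℂ) / j.factorial

/-- The coefficient of `x ^ (-t - j)` in the asymptotic expansion of
`t * ∑ m, (x + m + 1 - b) ^ (-t - 1)`. -/
def tailCoeff (b : ℝ) (j : ℕ) (t : ℂ) : ℂ := rising t j * bernoulliCoeff b j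

/-- The expansion of `t * ∑ m, (x + m + 1 - b) ^ (-t - 1)`, truncated after order `K`. -/
def tailExpansion (b : ℝ) (K : ℕ) (t : ℂ) (x : ℝ) : ℂ :=
  ∑ j ∈ Finset.range (K + 1), tailCoeff b j t * (x : ℂ) ^ (-t - j)

/-- The failure of the truncated expansion to satisfy the difference equation of the tail. -/
def tailDefect (b : ℝ) (K : ℕ) (t : ℂ) (x : ℝ) : ℂ :=
  t * ((x + (1 - b) : ℝ) : ℂ) ^ (-t - 1) - tailExpansion b K t x + tailExpansion b K t (x + 1)

theorem bernoulliCoeff_one_sub (b : ℝ) (j : ℕ) :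
    bernoulliCoeff (1 - b) j = (-1) ^ j * bernoulliCoeff b j := by
  have h := congr_arg (Polynomial.aeval b) (Polynomial.bernoulli_comp_one_sub_X j)
  rw [Polynomial.aeval_comp] at h
  simp only [map_sub, map_one, Polynomial.aeval_X, map_mul, map_pow, map_neg] at h
  rw [bernoulliCoeff, h, bernoulliCoeff]
  push_cast
  ring

theorem bernoulliCoeff_zero (b : ℝ) : bernoulliCoeff b 0 = 1 := by
  simp [bernoulliCoeff]

/-- The recursion for Bernoulli polynomials, that is, the coefficients of
`(x e^{βx} / (e^x - 1)) * (e^x - 1) = x e^{βx}`. -/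
theorem sum_bernoulliCoeff (β : ℝ) (n : ℕ) :
    ∑ k ∈ Finset.range (n + 1), bernoulliCoeff β k / ((n + 1 - k).factorial : ℂ) =
      (β : ℂ) ^ n / n.factorial := by
  have h := congr_arg (Polynomial.aeval β) (Polynomial.sum_bernoulli n)
  simp only [map_sum, map_smul, Polynomial.aeval_monomial] at h
  have h' : ∑ k ∈ Finset.range (n + 1), (((n + 1).choose k : ℕ) : ℂ) *
      ((Polynomial.aeval β (Polynomial.bernoulli k) : ℝ) : ℂ) = (n + 1) * (β : ℂ) ^ n := by
    have h2 := congr_arg (fun x : ℝ => (x : ℂ)) h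
    simp only [Complex.ofReal_sum, Algebra.smul_def] at h2
    simpa using h2
  have hf : ((n + 1).factorial : ℂ) ≠ 0 := by exact_mod_cast (n + 1).factorial_ne_zero
  have hn : (n.factorial : ℂ) ≠ 0 := by exact_mod_cast n.factorial_ne_zero
  have hn1 : (n : ℂ) + 1 ≠ 0 := by exact_mod_cast n.succ_ne_zero
  calc _ = (∑ k ∈ Finset.range (n + 1), (((n + 1).choose k : ℕ) : ℂ) *
      ((Polynomial.aeval β (Polynomial.bernoulli k) : ℝ) : ℂ)) / (n + 1).factorial := by
        rw [Finset.sum_div]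
        refine Finset.sum_congr rfl fun k hk => ?_
        rw [Nat.cast_choose ℂ (Finset.mem_range.1 hk).le, bernoulliCoeff]
        field_simp
    _ = _ := by
      rw [h', Nat.factorial_succ]
      push_cast
      field_simp

/-- Taylor's formula with a crude remainder, for a sequence of successive derivatives. -/
theorem norm_taylor_remainder_le (n : ℕ) : ∀ (g : ℕ → ℝ → ℂ) (x h C : ℝ), 0 ≤ h →
    (∀ j, ∀ y ∈ Set.Icc x (x + h), HasDerivAt (g j) (g (j + 1) y) y) →
    (∀ y ∈ Set.Icc x (x + h), ‖g n y‖ ≤ C) →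
    ‖g 0 (x + h) - ∑ i ∈ Finset.range n, g i x * ((h : ℂ) ^ i / i.factorial)‖ ≤ C * h ^ n := by
  induction n with
  | zero =>
    intro g x h C hh _ hC
    simpa using hC (x + h) ⟨by linarith, le_rfl⟩
  | succ n ih =>
    intro g x h C hh hg hC
    have hC0 : 0 ≤ C := (norm_nonneg _).trans (hC x ⟨le_rfl, by linarith⟩)
    let φ : ℝ → ℂ := fun u =>
      g 0 (x + u) - ∑ i ∈ Finset.range (n + 1), g i x * ((u : ℂ) ^ i / i.factorial)
    let φ' : ℝ → ℂ := fun u =>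
      g 1 (x + u) - ∑ i ∈ Finset.range n, g (i + 1) x * ((u : ℂ) ^ i / i.factorial)
    have hd : ∀ u ∈ Set.Icc 0 h, HasDerivWithinAt φ (φ' u) (Set.Icc 0 h) u := by
      intro u hu
      have h1 : HasDerivAt (fun u => g 0 (x + u)) (g 1 (x + u)) u :=
        (hg 0 (x + u) ⟨by linarith [hu.1], by linarith [hu.2]⟩).comp_const_add x u
      have h2 : HasDerivAt (fun u : ℝ => ∑ i ∈ Finset.range (n + 1),
          g i x * ((u : ℂ) ^ i / i.factorial))
          (∑ i ∈ Finset.range (n + 1), g i x * ((i * (u : ℂ) ^ (i - 1)) / i.factorial)) u := by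
        refine HasDerivAt.fun_sum fun i _ => ?_
        exact ((hasDerivAt_pow i (u : ℂ)).comp_ofReal.div_const _).const_mul _
      have h3 : ∑ i ∈ Finset.range (n + 1), g i x * ((i * (u : ℂ) ^ (i - 1)) / i.factorial) =
          ∑ i ∈ Finset.range n, g (i + 1) x * ((u : ℂ) ^ i / i.factorial) := by
        rw [Finset.sum_range_succ']
        simp only [Nat.cast_zero, zero_mul, zero_div, mul_zero, add_zero]
        refine Finset.sum_congr rfl fun i _ => ?_
        have : (i : ℂ) + 1 ≠ 0 := by exact_mod_cast i.succ_ne_zero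
        have hn : (i.factorial : ℂ) ≠ 0 := by exact_mod_cast i.factorial_ne_zero
        rw [Nat.factorial_succ, Nat.add_sub_cancel]
        push_cast
        field_simp
      rw [h3] at h2
      exact (h1.sub h2).hasDerivWithinAt
    have hb : ∀ u ∈ Set.Ico 0 h, ‖φ' u‖ ≤ C * h ^ n := by
      intro u hu
      refine (ih (fun j => g (j + 1)) x u C hu.1 (fun j y hy => hg _ y
        ⟨hy.1, by linarith [hy.2, hu.2]⟩) (fun y hy => hC y ⟨hy.1, by linarith [hy.2, hu.2]⟩)).trans
        ?_
      have := hu.1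
      have := hu.2.le
      gcongr
    have := norm_image_sub_le_of_norm_deriv_le_segment' hd hb h ⟨hh, le_rfl⟩
    have h0 : φ 0 = 0 := by
      simp only [φ]
      rw [Finset.sum_range_succ']
      simp
    rw [h0, sub_zero, sub_zero] at this
    calc _ ≤ _ := this
      _ = _ := by ring

/-- The `j`-th derivative of `y ↦ y ^ (-t)`. -/
def powDeriv (t : ℂ) (j : ℕ) (y : ℝ) : ℂ := (-1) ^ j * rising t j * (y : ℂ) ^ (-t - j)

theorem hasDerivAt_powDeriv (t : ℂ) (j : ℕ) {y : ℝ} (hy : 0 < y) :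
    HasDerivAt (powDeriv t j) (powDeriv t (j + 1) y) y := by
  have h1 : HasDerivAt (fun z : ℂ => z ^ (-t - j)) ((-t - j) * (y : ℂ) ^ (-t - j - 1)) (y : ℂ) := by
    have := (hasDerivAt_id (y : ℂ)).cpow_const (c := -t - j) (Or.inl (by simpa using hy))
    simpa using this
  have h2 := h1.comp_ofReal.const_mul ((-1) ^ j * rising t j)
  have e : powDeriv t (j + 1) y =
      (-1) ^ j * rising t j * ((-t - j) * (y : ℂ) ^ (-t - j - 1)) := by
    rw [powDeriv, rising, Finset.prod_range_succ, ← rising,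
      show -t - ((j + 1 : ℕ) : ℂ) = -t - j - 1 by push_cast; ring]
    ring
  rw [e]
  exact h2

theorem norm_rising_le {t : ℂ} {T : ℝ} (ht : ‖t‖ ≤ T) (n : ℕ) : ‖rising t n‖ ≤ (T + n) ^ n := by
  rw [rising, norm_prod]
  calc _ ≤ ∏ _l ∈ Finset.range n, (T + n) := by
        refine Finset.prod_le_prod (fun _ _ => norm_nonneg _) fun l hl => ?_
        refine (norm_add_le _ _).trans (add_le_add ht ?_)
        rw [Complex.norm_natCast]
        exact_mod_cast (Finset.mem_range.1 hl).le
    _ = _ := by simp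

theorem norm_powDeriv_le {t : ℂ} {T : ℝ} (ht : ‖t‖ ≤ T) (n : ℕ) {x y : ℝ} (hx : 1 ≤ x)
    (hxy : x ≤ y) (hyx : y ≤ x + 2) :
    ‖powDeriv t n y‖ ≤ (T + n) ^ n * 3 ^ (T + n) * x ^ (-t.re - n) := by
  have hx0 : 0 < x := by linarith
  have hy0 : 0 < y := by linarith
  have hT : 0 ≤ T := (norm_nonneg _).trans ht
  rw [powDeriv, norm_mul, norm_mul, norm_pow, norm_neg, norm_one, one_pow, one_mul,
    Complex.norm_cpow_eq_rpow_re_of_pos hy0]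
  have hre : |t.re| ≤ T := (Complex.abs_re_le_norm t).trans ht
  have h1 : y ^ (-t - n : ℂ).re ≤ 3 ^ (T + n) * x ^ (-t.re - n) := by
    have e : y = (y / x) * x := by field_simp
    simp only [Complex.sub_re, Complex.neg_re, Complex.natCast_re]
    have hq1 : 1 ≤ y / x := by rw [le_div_iff₀ hx0]; linarith
    have hq3 : y / x ≤ 3 := by rw [div_le_iff₀ hx0]; linarith
    conv_lhs => rw [e]
    rw [Real.mul_rpow (by positivity) hx0.le]
    gcongr
    calc (y / x) ^ (-t.re - (n : ℝ)) ≤ (y / x) ^ (T + n) := by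
          apply Real.rpow_le_rpow_of_exponent_le hq1
          have := neg_abs_le t.re
          have : (0 : ℝ) ≤ n := n.cast_nonneg
          linarith
      _ ≤ 3 ^ (T + n) := by
        apply Real.rpow_le_rpow (by positivity) hq3 (by positivity)
  rw [mul_assoc]
  exact mul_le_mul (norm_rising_le ht n) h1 (by positivity) (by positivity)

theorem tailExpansion_eq (b : ℝ) (K : ℕ) (t : ℂ) (x : ℝ) :
    tailExpansion b K t x =
      ∑ j ∈ Finset.range (K + 1), bernoulliCoeff (1 - b) j * powDeriv t j x := by
  refine Finset.sum_congr rfl fun j _ => ?_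
  rw [tailCoeff, powDeriv, bernoulliCoeff_one_sub]
  have : ((-1 : ℂ) ^ j) * (-1) ^ j = 1 := by rw [← mul_pow]; simp
  linear_combination (-(rising t j * bernoulliCoeff b j * (x : ℂ) ^ (-t - j))) * this

/-- The Taylor polynomials of the terms of `tailDefect` cancel; this is what singles out the
Bernoulli polynomials. -/
theorem sum_taylor_cancel (β : ℝ) (K : ℕ) (g : ℕ → ℂ) :
    ∑ j ∈ Finset.range (K + 1), bernoulliCoeff β j *
        (∑ i ∈ Finset.range (K + 1 - j), g (j + i) * (1 / i.factorial) - g j) =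
      ∑ i ∈ Finset.range K, g (1 + i) * ((β : ℂ) ^ i / i.factorial) := by
  have h1 : ∑ j ∈ Finset.range (K + 1), bernoulliCoeff β j *
        (∑ i ∈ Finset.range (K + 1 - j), g (j + i) * (1 / i.factorial)) =
      ∑ m ∈ Finset.range (K + 1), g m *
        ∑ k ∈ Finset.range (m + 1), bernoulliCoeff β k / ((m - k).factorial : ℂ) := by
    have := Finset.sum_range_diag_flip (K + 1)
      (fun j i => bernoulliCoeff β j * (g (j + i) * (1 / (i.factorial : ℂ))))
    simp only [Finset.mul_sum]
    rw [← this]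
    refine Finset.sum_congr rfl fun m _ => Finset.sum_congr rfl fun k hk => ?_
    rw [Nat.add_sub_cancel' (by have := Finset.mem_range.1 hk; omega)]
    ring
  simp only [mul_sub, Finset.sum_sub_distrib]
  rw [h1, ← Finset.sum_sub_distrib, Finset.sum_range_succ']
  simp only [zero_add, Finset.range_one, Finset.sum_singleton, Nat.sub_self, Nat.factorial_zero,
    Nat.cast_one, div_one]
  rw [mul_comm (g 0), sub_self, add_zero]
  refine Finset.sum_congr rfl fun m _ => ?_
  rw [Finset.sum_range_succ, sum_bernoulliCoeff, add_comm 1 m]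
  simp only [Nat.sub_self, Nat.factorial_zero, Nat.cast_one, div_one]
  ring

/-- By Taylor's formula the defect is of the order of the first omitted derivative, uniformly for
bounded `t`. -/
theorem exists_norm_tailDefect_le (b : ℝ) (hb₁ : -1 ≤ b) (hb₂ : b ≤ 1) (K : ℕ) (T : ℝ) :
    ∃ C, 0 ≤ C ∧ ∀ t : ℂ, ‖t‖ ≤ T → ∀ x : ℝ, 1 ≤ x →
      ‖tailDefect b K t x‖ ≤ C * x ^ (-t.re - (K + 1)) := by
  by_cases hT : 0 ≤ T
  swap
  · exact ⟨0, le_rfl, fun t ht => absurd ((norm_nonneg t).trans ht) hT⟩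
  set β := 1 - b with hβ
  let C₀ : ℝ := (T + (K + 1 : ℕ)) ^ (K + 1) * 3 ^ (T + (K + 1 : ℕ))
  have hC₀ : 0 ≤ C₀ := by positivity
  refine ⟨(∑ j ∈ Finset.range (K + 1), ‖bernoulliCoeff β j‖) * C₀ + C₀ * β ^ K,
    by
      have : 0 ≤ β := by linarith
      positivity, ?_⟩
  intro t ht x hx
  have hx0 : 0 < x := by linarith
  set X := x ^ (-t.re - (K + 1 : ℝ))
  have hX0 : 0 ≤ X := by positivity
  have hder : ∀ j, ∀ y, x ≤ y → HasDerivAt (powDeriv t j) (powDeriv t (j + 1) y) y :=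
    fun j y hy => hasDerivAt_powDeriv t j (by linarith)
  have hbd : ∀ y, x ≤ y → y ≤ x + 2 → ‖powDeriv t (K + 1) y‖ ≤ C₀ * X := by
    intro y h1 h2
    have := norm_powDeriv_le ht (K + 1) hx h1 h2
    push_cast at this ⊢
    simpa [C₀, X] using this
  -- the Taylor remainders of `powDeriv t j` at `x + 1` and of `powDeriv t 1` at `x + β`
  have r1 : ∀ j ∈ Finset.range (K + 1), ‖powDeriv t j (x + 1) -
      ∑ i ∈ Finset.range (K + 1 - j), powDeriv t (j + i) x * (1 / i.factorial)‖ ≤ C₀ * X := by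
    intro j hj
    have hj := Finset.mem_range.1 hj
    have := norm_taylor_remainder_le (K + 1 - j) (fun i => powDeriv t (j + i)) x 1 (C₀ * X)
      zero_le_one (fun i y hy => hder (j + i) y hy.1) (fun y hy => by
        rw [Nat.add_sub_cancel' hj.le]
        exact hbd y hy.1 (by linarith [hy.2]))
    simpa using this
  have r2 : ‖powDeriv t 1 (x + β) -
      ∑ i ∈ Finset.range K, powDeriv t (1 + i) x * ((β : ℂ) ^ i / i.factorial)‖ ≤
        C₀ * X * β ^ K := by
    refine norm_taylor_remainder_le K (fun i => powDeriv t (1 + i)) x β (C₀ * X)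
      (by linarith) (fun i y hy => hder (1 + i) y hy.1) (fun y hy => ?_)
    rw [add_comm 1 K]
    exact hbd y hy.1 (by linarith [hy.2])
  have e1 : tailDefect b K t x = ∑ j ∈ Finset.range (K + 1), bernoulliCoeff β j *
      (powDeriv t j (x + 1) -
        ∑ i ∈ Finset.range (K + 1 - j), powDeriv t (j + i) x * (1 / i.factorial)) -
      (powDeriv t 1 (x + β) -
        ∑ i ∈ Finset.range K, powDeriv t (1 + i) x * ((β : ℂ) ^ i / i.factorial)) := by
    rw [← sum_taylor_cancel β K (fun i => powDeriv t i x), tailDefect, tailExpansion_eq,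
      tailExpansion_eq]
    have e2 : powDeriv t 1 (x + β) = -(t * ((x + (1 - b) : ℝ) : ℂ) ^ (-t - 1)) := by
      simp [powDeriv, rising, hβ]
    rw [e2]
    simp only [mul_sub, Finset.sum_sub_distrib]
    ring
  rw [e1]
  refine (norm_sub_le _ _).trans ?_
  rw [add_mul]
  rw [mul_right_comm] at r2
  refine add_le_add ?_ r2
  refine (norm_sum_le _ _).trans ?_
  rw [Finset.sum_mul, Finset.sum_mul]
  refine Finset.sum_le_sum fun j hj => ?_
  rw [norm_mul, mul_assoc]
  exact mul_le_mul_of_nonneg_left (r1 j hj) (norm_nonneg _)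

/-- Comparison of `∑ (x + m) ^ (-p)` with the integral. -/
theorem summable_add_rpow_neg {p : ℝ} (hp : 1 < p) {x : ℝ} (hx : 1 ≤ x) :
    Summable (fun m : ℕ => (x + m) ^ (-p)) ∧
      ∑' m : ℕ, (x + m) ^ (-p) ≤ 2 ^ p / (p - 1) * x ^ (1 - p) := by
  have hp1 : 0 < p - 1 := by linarith
  have step : ∀ y : ℝ, 1 ≤ y →
      y ^ (-p) ≤ 2 ^ p / (p - 1) * (y ^ (1 - p) - (y + 1) ^ (1 - p)) := by
    intro y hy
    have hy0 : 0 < y := by linarith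
    have hy1 : 0 < y + 1 := by linarith
    have h1 : (p - 1) * (y + 1) ^ (-p) ≤ y ^ (1 - p) - (y + 1) ^ (1 - p) := by
      set u := y / (y + 1) with hu
      have hu0 : 0 < u := by positivity
      have e : y ^ (1 - p) = u ^ (1 - p) * (y + 1) ^ (1 - p) := by
        rw [← Real.mul_rpow hu0.le hy1.le]; congr 1; rw [hu]; field_simp
      have h2 : 1 + (p - 1) / (y + 1) ≤ u ^ (1 - p) := by
        rw [Real.rpow_def_of_pos hu0]
        have h3 := Real.add_one_le_exp (Real.log u * (1 - p))
        have h4 := Real.log_le_sub_one_of_pos hu0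
        have h5 : u - 1 = -(1 / (y + 1)) := by rw [hu]; field_simp; ring
        rw [h5] at h4
        have h6 : (p - 1) / (y + 1) ≤ Real.log u * (1 - p) := by
          calc (p - 1) / (y + 1) = (p - 1) * (1 / (y + 1)) := by ring
            _ ≤ (p - 1) * (-Real.log u) := by
              apply mul_le_mul_of_nonneg_left _ hp1.le
              linarith
            _ = _ := by ring
        linarith
      have h7 : (y + 1) ^ (-p) = (y + 1) ^ (1 - p) / (y + 1) := by
        rw [show -p = (1 - p) - 1 by ring, Real.rpow_sub_one hy1.ne']
      have h8 := mul_le_mul_of_nonneg_right h2 (Real.rpow_nonneg hy1.le (1 - p))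
      rw [e, h7]
      calc _ = (1 + (p - 1) / (y + 1)) * (y + 1) ^ (1 - p) - (y + 1) ^ (1 - p) := by ring
        _ ≤ _ := by linarith
    have h9 : y ^ (-p) ≤ 2 ^ p * (y + 1) ^ (-p) := by
      have : y ^ (-p) = 2 ^ p * (2 * y) ^ (-p) := by
        rw [Real.mul_rpow (by norm_num) hy0.le, ← mul_assoc, ← Real.rpow_add (by norm_num)]
        simp
      rw [this]
      refine mul_le_mul_of_nonneg_left ?_ (by positivity)
      exact Real.rpow_le_rpow_of_nonpos hy1 (by linarith) (by linarith)
    calc y ^ (-p) ≤ 2 ^ p * (y + 1) ^ (-p) := h9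
      _ = 2 ^ p / (p - 1) * ((p - 1) * (y + 1) ^ (-p)) := by field_simp
      _ ≤ _ := mul_le_mul_of_nonneg_left h1 (by positivity)
  have hpart : ∀ N : ℕ, ∑ m ∈ Finset.range N, (x + m) ^ (-p) ≤
      2 ^ p / (p - 1) * x ^ (1 - p) := by
    intro N
    calc _ ≤ ∑ m ∈ Finset.range N, 2 ^ p / (p - 1) *
          ((x + m) ^ (1 - p) - (x + (m + 1 : ℕ)) ^ (1 - p)) := by
          refine Finset.sum_le_sum fun m _ => ?_
          have := step (x + m) (by have : (0 : ℝ) ≤ m := m.cast_nonneg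
                                   linarith)
          push_cast
          rwa [← add_assoc]
      _ = 2 ^ p / (p - 1) * (x ^ (1 - p) - (x + N) ^ (1 - p)) := by
        rw [← Finset.mul_sum, Finset.sum_range_sub']
        simp
      _ ≤ _ := by
        apply mul_le_mul_of_nonneg_left _ (by positivity)
        have : 0 ≤ (x + N) ^ (1 - p) := by positivity
        linarith
  have h0 : ∀ m : ℕ, 0 ≤ (x + m) ^ (-p) := fun m => by positivity
  exact ⟨summable_of_sum_range_le h0 hpart, Real.tsum_le_of_sum_range_le h0 hpart⟩

theorem tendsto_tailExpansion {b : ℝ} {K : ℕ} {t : ℂ} (ht : 0 < t.re) {x : ℝ} (hx : 1 ≤ x) :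
    Tendsto (fun m : ℕ => tailExpansion b K t (x + m)) atTop (𝓝 0) := by
  have h : ∀ j ∈ Finset.range (K + 1), Tendsto (fun m : ℕ =>
      tailCoeff b j t * ((x + m : ℝ) : ℂ) ^ (-t - j)) atTop (𝓝 0) := by
    intro j _
    have h1 : Tendsto (fun m : ℕ => ((x + m : ℝ) : ℂ) ^ (-t - j)) atTop (𝓝 0) := by
      rw [tendsto_zero_iff_norm_tendsto_zero]
      have h2 : Tendsto (fun m : ℕ => x + (m : ℝ)) atTop atTop :=
        tendsto_atTop_add_const_left _ _ tendsto_natCast_atTop_atTop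
      have h3 := (tendsto_rpow_neg_atTop (y := t.re + j) (by positivity)).comp h2
      refine h3.congr fun m => ?_
      rw [Complex.norm_cpow_eq_rpow_re_of_pos (by positivity)]
      simp only [Function.comp, Complex.sub_re, Complex.neg_re, Complex.natCast_re]
      congr 1; ring
    simpa using h1.const_mul (tailCoeff b j t)
  simpa [tailExpansion] using tendsto_finsetSum _ h

theorem summable_tailDefect {b : ℝ} (hb₁ : -1 ≤ b) (hb₂ : b ≤ 1) (K : ℕ) {t : ℂ}
    (ht : -K < t.re) {x : ℝ} (hx : 1 ≤ x) :
    Summable fun m : ℕ => tailDefect b K t (x + m) := by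
  obtain ⟨C, _, hC⟩ := exists_norm_tailDefect_le b hb₁ hb₂ K ‖t‖
  refine Summable.of_norm_bounded
    (((summable_add_rpow_neg (p := t.re + (K + 1)) (by linarith) hx).1).mul_left C) fun m => ?_
  have := hC t le_rfl (x + m) (by have : (0 : ℝ) ≤ m := m.cast_nonneg
                                  linarith)
  rwa [show -(t.re + ((K : ℝ) + 1)) = -t.re - (K + 1) by ring]

/-- The Euler–Maclaurin formula for the tail of a Hurwitz zeta series, multiplied by `t` to remove
the pole at `t = 0`. -/
theorem hasSum_tail {b : ℝ} (hb₁ : -1 ≤ b) (hb₂ : b ≤ 1) (K : ℕ) {t : ℂ} (ht : 0 < t.re) {x : ℝ}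
    (hx : 1 ≤ x) :
    HasSum (fun m : ℕ => t * ((x + m + (1 - b) : ℝ) : ℂ) ^ (-t - 1))
      (tailExpansion b K t x + ∑' m : ℕ, tailDefect b K t (x + m)) := by
  have hD := summable_tailDefect hb₁ hb₂ K (t := t)
    (by have : (0 : ℝ) ≤ K := K.cast_nonneg
        linarith) hx
  have hs : Summable fun m : ℕ => t * ((x + m + (1 - b) : ℝ) : ℂ) ^ (-t - 1) := by
    refine Summable.mul_left _ (Summable.of_norm_bounded
      (summable_add_rpow_neg (p := t.re + 1) (by linarith) hx).1 fun m => ?_)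
    have h0 : 0 < x + m := by positivity
    rw [Complex.norm_cpow_eq_rpow_re_of_pos (by linarith)]
    simp only [Complex.sub_re, Complex.neg_re, Complex.one_re]
    rw [show -(t.re + 1) = -t.re - 1 by ring]
    exact Real.rpow_le_rpow_of_nonpos h0 (by linarith) (by linarith)
  have hnext : ∀ m : ℕ, x + ((m + 1 : ℕ) : ℝ) = x + m + 1 := fun m => by
    push_cast
    ring
  have htel : HasSum (fun m : ℕ => tailExpansion b K t (x + m) -
      tailExpansion b K t (x + (m + 1 : ℕ))) (tailExpansion b K t x) := by
    have hs' : Summable (fun m : ℕ => tailExpansion b K t (x + m) -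
        tailExpansion b K t (x + (m + 1 : ℕ))) := by
      refine (hs.sub hD).congr fun m => ?_
      rw [tailDefect, hnext]
      ring
    rw [hs'.hasSum_iff_tendsto_nat]
    simp_rw [Finset.sum_range_sub' (fun m : ℕ => tailExpansion b K t (x + m))]
    simpa using (tendsto_tailExpansion (b := b) (K := K) ht hx).const_sub
      (tailExpansion b K t (x + (0 : ℕ)))
  refine (htel.add hD.hasSum).congr_fun fun m => ?_
  rw [tailDefect, hnext]
  ring

theorem analyticAt_cpow_left {x : ℝ} (hx : 0 < x) (t : ℂ) :
    AnalyticAt ℂ (fun t : ℂ => (x : ℂ) ^ t) t := by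
  have hx' : (x : ℂ) ≠ 0 := by exact_mod_cast hx.ne'
  refine (analyticAt_const.mul analyticAt_id).cexp.congr
    (f := fun t => Complex.exp (Complex.log x * t)) ?_
  exact .of_forall fun z => by simp only [Complex.cpow_def_of_ne_zero hx']

theorem analyticAt_rising (j : ℕ) (t : ℂ) : AnalyticAt ℂ (fun t => rising t j) t :=
  Finset.analyticAt_fun_prod _ fun _ _ => analyticAt_id.add analyticAt_const

theorem analyticAt_tailCoeff (b : ℝ) (j : ℕ) (t : ℂ) : AnalyticAt ℂ (tailCoeff b j) t :=
  (analyticAt_rising j t).mul analyticAt_const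

theorem analyticAt_tailExpansion (b : ℝ) (K : ℕ) {x : ℝ} (hx : 0 < x) (t : ℂ) :
    AnalyticAt ℂ (fun t => tailExpansion b K t x) t := by
  refine Finset.analyticAt_fun_sum _ fun j _ => (analyticAt_tailCoeff b j t).mul ?_
  exact (analyticAt_cpow_left hx _).comp (g := fun t : ℂ => (x : ℂ) ^ t)
    (f := fun t : ℂ => -t - j) (analyticAt_id.neg.sub analyticAt_const)

theorem analyticAt_tailDefect {b : ℝ} (hb₂ : b ≤ 1) (K : ℕ) {x : ℝ} (hx : 0 < x) (t : ℂ) :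
    AnalyticAt ℂ (fun t => tailDefect b K t x) t := by
  refine ((analyticAt_id.mul ?_).sub (analyticAt_tailExpansion b K hx t)).add
    (analyticAt_tailExpansion b K (by linarith) t)
  exact (analyticAt_cpow_left (by linarith) _).comp (g := fun t : ℂ => ((x + (1 - b) : ℝ) : ℂ) ^ t)
    (f := fun t : ℂ => -t - 1) (analyticAt_id.neg.sub analyticAt_const)

theorem rising_zero_of_pos {j : ℕ} (hj : 0 < j) : rising 0 j = 0 :=
  Finset.prod_eq_zero (Finset.mem_range.2 hj) (by simp)

theorem tailCoeff_zero_apply (b : ℝ) (j : ℕ) : tailCoeff b j 0 = if j = 0 then 1 else 0 := by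
  split_ifs with h
  · subst h; simp [tailCoeff, rising, bernoulliCoeff_zero]
  · rw [tailCoeff, rising_zero_of_pos (Nat.pos_of_ne_zero h), zero_mul]

theorem tailDefect_zero (b : ℝ) (K : ℕ) {x : ℝ} : tailDefect b K 0 x = 0 := by
  have h : ∀ y : ℝ, tailExpansion b K 0 y = 1 := by
    intro y
    simp [tailExpansion, tailCoeff_zero_apply]
  simp [tailDefect, h]

end EulerMaclaurin

/-! ### Summation over the largest index -/

section Peeling

variable {r : ℕ}

/-- The largest index `n₁`, and `0` in depth `0`. -/
def leadIndex (n : Index r) : ℕ := if h : 0 < r then n.1 ⟨0, h⟩ else 0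

/-- The first parameter `α₁`, and `1` in depth `0`. -/
def leadShift (α : Fin r → ℝ) : ℝ := if h : 0 < r then α ⟨0, h⟩ else 1

/-- The number `n₁ + α₁`. In depth `0` it is `1`, so that depth `1` is treated like the others. -/
def leadBase (α : Fin r → ℝ) (n : Index r) : ℝ := leadIndex n + leadShift α

/-- `α₂ - α₁`, the argument of the Bernoulli polynomials in the expansion of the sum over `n₁`. -/
def shiftGap (α : Fin (r + 1) → ℝ) : ℝ := leadShift (Fin.tail α) - α 0

/-- The affine map `(s₁, s₂, s₃, …) ↦ (s₁ + s₂ - 1 + j, s₃, …)`. -/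
def shiftMap (j : ℕ) (s : Fin (r + 1) → ℂ) : Fin r → ℂ :=
  fun i => s i.succ + if i.val = 0 then s 0 - 1 + j else 0

/-- The translate of the domain of convergence on which `shiftMap j` takes values in the domain of
convergence for all `j ≥ K`. -/
def extendedDomain (r K : ℕ) : Set (Fin r → ℂ) :=
  {s | ∀ i : ℕ, 1 ≤ i → i ≤ r → (i : ℝ) - K < (partialSum s i).re}

theorem leadShift_succ (α : Fin (r + 1) → ℝ) : leadShift α = α 0 := by simp [leadShift]

theorem leadIndex_succ (n : Index (r + 1)) : leadIndex n = n.1 0 := by simp [leadIndex]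

theorem le_leadIndex (n : Index r) (i : Fin r) : n.1 i ≤ leadIndex n := by
  have h : 0 < r := i.pos
  rw [leadIndex, dif_pos h]
  exact n.2.1.antitone (Fin.mk_le_of_le_val (Nat.zero_le _))

theorem one_le_leadBase {α : Fin r → ℝ} (hα : ∀ j, 0 ≤ α j ∧ α j < 1) (n : Index r) :
    1 ≤ leadBase α n := by
  rw [leadBase, leadIndex, leadShift]
  split_ifs with h
  · have h1 : (1 : ℝ) ≤ n.1 ⟨0, h⟩ := by exact_mod_cast n.2.2 _
    linarith [(hα ⟨0, h⟩).1]
  · simp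

theorem tail_mem_Ico {α : Fin (r + 1) → ℝ} (hα : ∀ j, 0 ≤ α j ∧ α j < 1) :
    ∀ j, 0 ≤ Fin.tail α j ∧ Fin.tail α j < 1 := fun j => hα j.succ

theorem shiftGap_mem {α : Fin (r + 1) → ℝ} (hα : ∀ j, 0 ≤ α j ∧ α j < 1) :
    -1 ≤ shiftGap α ∧ shiftGap α ≤ 1 := by
  have h0 := hα 0
  rw [shiftGap, leadShift]
  split_ifs with h
  · have h1 := tail_mem_Ico hα ⟨0, h⟩
    constructor <;> linarith
  · constructor <;> linarith

theorem partialSum_succ (s : Fin (r + 1) → ℂ) (m : ℕ) :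
    partialSum s (m + 1) = s 0 + partialSum (Fin.tail s) m := by
  simp only [partialSum, Finset.sum_filter, Fin.sum_univ_succ, Fin.val_succ, Fin.val_zero,
    Nat.succ_pos, if_true, Nat.add_lt_add_iff_right, Fin.tail]

theorem partialSum_zero (s : Fin r → ℂ) : partialSum s 0 = 0 := by simp [partialSum]

theorem partialSum_shiftMap (j : ℕ) (s : Fin (r + 1) → ℂ) {i : ℕ} (hi : 1 ≤ i) (hir : i ≤ r) :
    partialSum (shiftMap j s) i = partialSum s (i + 1) - 1 + j := by
  obtain ⟨i, rfl⟩ := Nat.exists_eq_add_of_le' hi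
  obtain ⟨r, rfl⟩ := Nat.exists_eq_add_of_le' (hi.trans hir)
  rw [partialSum_succ, partialSum_succ, partialSum_succ]
  have : Fin.tail (shiftMap j s) = Fin.tail (Fin.tail s) := by
    ext l; simp [shiftMap, Fin.tail]
  rw [this]
  simp [shiftMap, Fin.tail]
  ring

theorem convergenceDomain_eq (r : ℕ) : convergenceDomain r = extendedDomain r 0 := by
  simp [convergenceDomain, extendedDomain]

theorem convergenceDomain_subset (r K : ℕ) : convergenceDomain r ⊆ extendedDomain r K := by
  intro s hs i h1 h2
  have := hs i h1 h2
  have : (0 : ℝ) ≤ K := K.cast_nonneg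
  linarith

theorem extendedDomain_mono {r K K' : ℕ} (h : K ≤ K') :
    extendedDomain r K ⊆ extendedDomain r K' := by
  intro s hs i h1 h2
  have := hs i h1 h2
  have : (K : ℝ) ≤ K' := by exact_mod_cast h
  linarith

theorem shiftMap_mem {K j : ℕ} (hj : K ≤ j) {s : Fin (r + 1) → ℂ}
    (hs : s ∈ extendedDomain (r + 1) K) : shiftMap j s ∈ convergenceDomain r := by
  intro i h1 h2
  have h := hs (i + 1) (by omega) (by omega)
  have : (K : ℝ) ≤ j := by exact_mod_cast hj
  rw [partialSum_shiftMap j s h1 h2]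
  simp only [Complex.add_re, Complex.sub_re, Complex.one_re, Complex.natCast_re]
  push_cast at h
  linarith

theorem continuous_partialSum (m : ℕ) : Continuous fun s : Fin r → ℂ => partialSum s m :=
  continuous_finsetSum _ fun j _ => continuous_apply j

theorem isOpen_extendedDomain (r K : ℕ) : IsOpen (extendedDomain r K) := by
  have : extendedDomain r K = ⋂ i ∈ Finset.Icc 1 r, {s | (i : ℝ) - K < (partialSum s i).re} := by
    ext s; simp [extendedDomain]
  rw [this]
  exact isOpen_biInter_finset fun i _ => isOpen_lt continuous_const
    (Complex.continuous_re.comp (continuous_partialSum i))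

theorem convex_extendedDomain (r K : ℕ) : Convex ℝ (extendedDomain r K) := by
  have : extendedDomain r K = ⋂ i ∈ Finset.Icc 1 r, {s | (i : ℝ) - K < (partialSum s i).re} := by
    ext s; simp [extendedDomain]
  rw [this]
  refine convex_iInter₂ fun i _ => convex_halfSpace_gt (f := fun s => (partialSum s i).re)
    ⟨fun x y => ?_, fun c x => ?_⟩ _
  · simp [partialSum, Finset.sum_add_distrib]
  · simp [partialSum, Finset.mul_sum]

theorem exists_mem_extendedDomain (s : Fin r → ℂ) : ∃ K, s ∈ extendedDomain r K := by
  have h : ∀ i : ℕ, ∀ᶠ K : ℕ in atTop, (i : ℝ) - K < (partialSum s i).re := by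
    intro i
    filter_upwards [eventually_gt_atTop ⌈(i : ℝ) - (partialSum s i).re⌉₊] with K hK
    have := Nat.lt_of_ceil_lt hK
    linarith
  have h2 : ∀ᶠ K : ℕ in atTop, ∀ i ∈ Finset.Icc 1 r, (i : ℝ) - K < (partialSum s i).re :=
    (Finset.eventually_all _).2 fun i _ => h i
  obtain ⟨K, hK⟩ := h2.exists
  exact ⟨K, fun i h1 h2 => hK i (Finset.mem_Icc.2 ⟨h1, h2⟩)⟩

theorem convergenceDomain_nonempty (r : ℕ) : (convergenceDomain r).Nonempty := by
  refine ⟨fun _ => 2, fun i h1 h2 => ?_⟩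
  have h3 : (Finset.univ.filter (fun j : Fin r => j.val < i)).card = i := by
    rw [Fin.card_filter_val_lt]; omega
  simp only [partialSum, Finset.sum_const, h3, nsmul_eq_mul]
  have : (1 : ℝ) ≤ i := by exact_mod_cast h1
  simp
  linarith

/-- The indices `n₁ > n₂ > ⋯` are parametrized by `(n₂, …)` and `n₁ - n₂ - 1`. -/
def indexEquiv (r : ℕ) : Index r × ℕ ≃ Index (r + 1) where
  toFun x := ⟨Fin.cons (leadIndex x.1 + x.2 + 1) x.1.1, by
    refine ⟨fun i j hij => ?_, fun j => ?_⟩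
    · cases i using Fin.cases with
      | zero =>
        cases j using Fin.cases with
        | zero => exact absurd hij (lt_irrefl _)
        | succ j =>
          have := le_leadIndex x.1 j
          simp only [Fin.cons_zero, Fin.cons_succ]
          omega
      | succ i =>
        cases j using Fin.cases with
        | zero => exact absurd hij (Fin.not_lt_zero _)
        | succ j => simpa using x.1.2.1 (Fin.succ_lt_succ_iff.1 hij)
    · cases j using Fin.cases with
      | zero => simp
      | succ j => simpa using x.1.2.2 j⟩
  invFun n := (⟨Fin.tail n.1, fun i j hij => n.2.1 (Fin.succ_lt_succ_iff.2 hij),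
    fun j => n.2.2 j.succ⟩,
    n.1 0 - leadIndex (⟨Fin.tail n.1, fun i j hij => n.2.1 (Fin.succ_lt_succ_iff.2 hij),
      fun j => n.2.2 j.succ⟩ : Index r) - 1)
  left_inv := by
    rintro ⟨n, m⟩
    ext1
    · simp
    · change leadIndex n + m + 1 - leadIndex n - 1 = m
      omega
  right_inv := by
    intro n
    apply Subtype.ext
    have hlt : leadIndex (⟨Fin.tail n.1, fun i j hij => n.2.1 (Fin.succ_lt_succ_iff.2 hij),
      fun j => n.2.2 j.succ⟩ : Index r) < n.1 0 := by
      rw [leadIndex]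
      split_ifs with h
      · exact n.2.1 (Fin.succ_pos _)
      · exact n.2.2 0
    ext i
    cases i using Fin.cases with
    | zero => simp only [Fin.cons_zero]; omega
    | succ i => simp [Fin.tail]

theorem index_base_pos {α : Fin r → ℝ} (hα : ∀ j, 0 ≤ α j ∧ α j < 1) (n : Index r) (j : Fin r) :
    1 ≤ (n.1 j : ℝ) + α j := by
  have h1 : (1 : ℝ) ≤ n.1 j := by exact_mod_cast n.2.2 j
  linarith [(hα j).1]

theorem zetaTerm_eq_prod (α : Fin r → ℝ) (s : Fin r → ℂ) (n : Index r) :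
    zetaTerm α s n = ∏ j, (((n.1 j : ℝ) + α j : ℝ) : ℂ) ^ (-s j) := by
  simp only [zetaTerm, Complex.cpow_neg, one_div, Finset.prod_inv_distrib]
  push_cast
  rfl

theorem norm_zetaTerm {α : Fin r → ℝ} (hα : ∀ j, 0 ≤ α j ∧ α j < 1) (s : Fin r → ℂ)
    (n : Index r) : ‖zetaTerm α s n‖ = ∏ j, ((n.1 j : ℝ) + α j) ^ (-(s j).re) := by
  rw [zetaTerm_eq_prod, norm_prod]
  refine Finset.prod_congr rfl fun j _ => ?_
  have := index_base_pos hα n j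
  rw [Complex.norm_cpow_eq_rpow_re_of_pos (by linarith), Complex.neg_re]

theorem zetaTerm_indexEquiv (α : Fin (r + 1) → ℝ) (s : Fin (r + 1) → ℂ) (n : Index r) (m : ℕ) :
    zetaTerm α s (indexEquiv r (n, m)) =
      ((leadBase (Fin.tail α) n + m + (1 - shiftGap α) : ℝ) : ℂ) ^ (-s 0) *
        zetaTerm (Fin.tail α) (Fin.tail s) n := by
  rw [zetaTerm_eq_prod, Fin.prod_univ_succ, zetaTerm_eq_prod]
  congr 2
  simp only [indexEquiv, Equiv.coe_fn_mk, Fin.cons_zero, leadBase, shiftGap]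
  push_cast
  ring

theorem zetaTerm_shiftMap {α : Fin r → ℝ} (hα : ∀ j, 0 ≤ α j ∧ α j < 1) (j : ℕ)
    (s : Fin (r + 1) → ℂ) (n : Index r) :
    zetaTerm α (shiftMap j s) n =
      (leadBase α n : ℂ) ^ (-(s 0 - 1) - j) * zetaTerm α (Fin.tail s) n := by
  cases r with
  | zero => simp [zetaTerm, leadBase, leadIndex, leadShift]
  | succ r =>
    have hb := one_le_leadBase hα n
    have hb0 : (leadBase α n : ℂ) ≠ 0 := by
      have : leadBase α n ≠ 0 := by linarith
      exact_mod_cast this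
    rw [zetaTerm_eq_prod, Fin.prod_univ_succ, zetaTerm_eq_prod, Fin.prod_univ_succ, ← mul_assoc]
    congr 1
    · have e : ((n.1 0 : ℝ) + α 0) = leadBase α n := by
        rw [leadBase, leadIndex_succ, leadShift_succ]
      rw [e, ← Complex.cpow_add _ _ hb0]
      congr 1
      simp [shiftMap, Fin.tail]
      ring
    · simp [shiftMap, Fin.tail]

theorem summable_prod_leadBase {α : Fin r → ℝ} (hα : ∀ j, 0 ≤ α j ∧ α j < 1) {p : ℝ}
    (c : Index r → ℝ) (hc : ∀ n, 0 ≤ c n)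
    (hs : 1 < p) (hS' : Summable fun n =>
      leadBase α n ^ (1 - p) * c n) :
    Summable fun x : Index r × ℕ =>
      (leadBase α x.1 + x.2) ^ (-p) * c x.1 := by
  have hpos : ∀ (n : Index r) (m : ℕ), 0 < leadBase α n + m := fun n m => by
    have := one_le_leadBase hα n
    positivity
  have h0 : ∀ x : Index r × ℕ, 0 ≤ (leadBase α x.1 + x.2) ^ (-p) * c x.1 :=
    fun x => mul_nonneg (Real.rpow_nonneg (hpos _ _).le _) (hc _)
  have h1 : ∀ n, Summable fun m : ℕ => (leadBase α n + m) ^ (-p) * c n := fun n =>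
    (summable_add_rpow_neg hs (one_le_leadBase hα n)).1.mul_right _
  have h2 : Summable fun n => ∑' m : ℕ, (leadBase α n + m) ^ (-p) * c n := by
    refine Summable.of_nonneg_of_le (fun n => tsum_nonneg fun m => h0 (n, m)) (fun n => ?_)
      (hS'.mul_left (2 ^ p / (p - 1)))
    have hb := (summable_add_rpow_neg hs (one_le_leadBase hα n)).2
    calc ∑' m : ℕ, (leadBase α n + m) ^ (-p) * c n
        = (∑' m : ℕ, (leadBase α n + m) ^ (-p)) * c n := tsum_mul_right
      _ ≤ (2 ^ p / (p - 1) * leadBase α n ^ (1 - p)) * c n :=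
        mul_le_mul_of_nonneg_right hb (hc _)
      _ = _ := mul_assoc _ _ _
  exact (summable_prod_of_nonneg h0).2 ⟨h1, h2⟩

theorem summable_lead {α : Fin r → ℝ} (hα : ∀ j, 0 ≤ α j ∧ α j < 1) {K : ℕ}
    {s : Fin (r + 1) → ℂ} (hs : 1 < (s 0).re + K)
    (hS : Summable fun n => ‖zetaTerm α (shiftMap K s) n‖) :
    Summable fun x : Index r × ℕ =>
      (leadBase α x.1 + x.2) ^ (-((s 0).re + K)) * ‖zetaTerm α (Fin.tail s) x.1‖ := by
  refine summable_prod_leadBase hα (fun n => ‖zetaTerm α (Fin.tail s) n‖)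
    (fun n => norm_nonneg _) hs
    (hS.congr fun n => ?_)
  have hb := one_le_leadBase hα n
  rw [zetaTerm_shiftMap hα, norm_mul, Complex.norm_cpow_eq_rpow_re_of_pos (by linarith)]
  congr 2
  simp only [Complex.sub_re, Complex.neg_re, Complex.one_re, Complex.natCast_re]
  ring

theorem first_re_gt {K : ℕ} {s : Fin (r + 1) → ℂ} (hs : s ∈ extendedDomain (r + 1) K) :
    1 < (s 0).re + K := by
  have := hs 1 le_rfl (by omega)
  rw [partialSum_succ, partialSum_zero, add_zero] at this
  push_cast at this
  linarith

/-- The series converges absolutely on the domain of convergence. -/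
theorem summable_norm_zetaTerm : ∀ {r : ℕ} {α : Fin r → ℝ}, (∀ j, 0 ≤ α j ∧ α j < 1) →
    ∀ {s : Fin r → ℂ}, s ∈ convergenceDomain r → Summable fun n => ‖zetaTerm α s n‖ := by
  intro r
  induction r with
  | zero => intro α _ s _; exact Summable.of_finite
  | succ r ih =>
    intro α hα s hs
    have hα' := tail_mem_Ico hα
    rw [convergenceDomain_eq] at hs
    have h := summable_lead hα' (first_re_gt hs) (ih hα' (shiftMap_mem le_rfl hs))
    rw [← (indexEquiv r).summable_iff]
    refine Summable.of_nonneg_of_le (fun x => norm_nonneg _) (fun x => ?_) h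
    obtain ⟨n, m⟩ := x
    simp only [Function.comp]
    rw [zetaTerm_indexEquiv, norm_mul]
    refine mul_le_mul_of_nonneg_right ?_ (norm_nonneg _)
    have h1 := one_le_leadBase hα' n
    have h2 := (shiftGap_mem hα).2
    have h3 : (0 : ℝ) ≤ m := m.cast_nonneg
    have h4 := first_re_gt hs
    rw [Complex.norm_cpow_eq_rpow_re_of_pos (by linarith), Complex.neg_re]
    simp only [Nat.cast_zero, add_zero] at h4 ⊢
    exact Real.rpow_le_rpow_of_nonpos (by linarith) (by linarith) (by linarith)

theorem norm_zetaTerm_le {α : Fin r → ℝ} (hα : ∀ j, 0 ≤ α j ∧ α j < 1) {s σ : Fin r → ℂ}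
    (h : ∀ j, (σ j).re ≤ (s j).re) (n : Index r) : ‖zetaTerm α s n‖ ≤ ‖zetaTerm α σ n‖ := by
  rw [norm_zetaTerm hα, norm_zetaTerm hα]
  refine Finset.prod_le_prod (fun j _ => ?_) fun j _ => ?_
  · have := index_base_pos hα n j
    positivity
  · exact Real.rpow_le_rpow_of_exponent_le (index_base_pos hα n j) (neg_le_neg (h j))

theorem analyticAt_coord (j : Fin r) (s : Fin r → ℂ) :
    AnalyticAt ℂ (fun s : Fin r → ℂ => s j) s :=
  (ContinuousLinearMap.proj (R := ℂ) (φ := fun _ : Fin r => ℂ) j).analyticAt s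

theorem analyticAt_zetaTerm {α : Fin r → ℝ} (hα : ∀ j, 0 ≤ α j ∧ α j < 1) (n : Index r)
    (s : Fin r → ℂ) : AnalyticAt ℂ (fun s => zetaTerm α s n) s := by
  simp only [zetaTerm_eq_prod]
  refine Finset.analyticAt_fun_prod _ fun j _ => ?_
  have := index_base_pos hα n j
  exact (analyticAt_cpow_left (x := (n.1 j : ℝ) + α j) (by linarith) (-s j)).comp
    (f := fun s : Fin r → ℂ => -s j) (analyticAt_coord j s).neg

/-- Near a point of the domain the real parts of all coordinates are bounded below by those of
another point of the domain. -/
theorem exists_lower_point {K : ℕ} {s₀ : Fin r → ℂ} (hs : s₀ ∈ extendedDomain r K) :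
    ∃ ε > 0, ∃ σ ∈ extendedDomain r K, ∀ s ∈ Metric.ball s₀ ε, ∀ j, (σ j).re ≤ (s j).re := by
  have hc : Continuous fun ε : ℝ => (fun i => s₀ i - ε : Fin r → ℂ) := by fun_prop
  have h0 : ∀ᶠ ε : ℝ in 𝓝 0, (fun i => s₀ i - ε : Fin r → ℂ) ∈ extendedDomain r K :=
    hc.continuousAt.eventually_mem ((isOpen_extendedDomain r K).mem_nhds (by simpa using hs))
  obtain ⟨δ, hδ, hb⟩ := Metric.eventually_nhds_iff_ball.1 h0
  refine ⟨δ / 2, by positivity, _, hb (δ / 2) ?_, fun s hs j => ?_⟩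
  · rw [Metric.mem_ball, Real.dist_eq, sub_zero, abs_of_pos (by positivity)]; linarith
  · have h1 : ‖s j - s₀ j‖ ≤ ‖s - s₀‖ := norm_le_pi_norm (s - s₀) j
    have h2 : ‖s - s₀‖ < δ / 2 := by rwa [mem_ball_iff_norm] at hs
    have h3 := (abs_le.1 (Complex.abs_re_le_norm (s j - s₀ j))).1
    simp only [Complex.sub_re, Complex.ofReal_re] at h3 ⊢
    linarith

theorem analyticAt_tsum_zetaTerm {α : Fin r → ℝ} (hα : ∀ j, 0 ≤ α j ∧ α j < 1) {s₀ : Fin r → ℂ}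
    (hs : s₀ ∈ convergenceDomain r) : AnalyticAt ℂ (fun s => ∑' n, zetaTerm α s n) s₀ := by
  rw [convergenceDomain_eq] at hs
  obtain ⟨ε, hε, σ, hσ, hle⟩ := exists_lower_point hs
  rw [← convergenceDomain_eq] at hσ
  exact analyticAt_tsum_of_ball hε (summable_norm_zetaTerm hα hσ)
    (fun n s _ => analyticAt_zetaTerm hα n s) (fun n s hs => norm_zetaTerm_le hα (hle s hs) n)

/-- The general term of the remainder series. -/
def remainderTerm (α : Fin (r + 1) → ℝ) (K : ℕ) (s : Fin (r + 1) → ℂ) (x : Index r × ℕ) : ℂ :=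
  tailDefect (shiftGap α) K (s 0 - 1) (leadBase (Fin.tail α) x.1 + x.2) *
    zetaTerm (Fin.tail α) (Fin.tail s) x.1

/-- What is left of `(s₁ - 1) ζ_{r+1}(s)` after the sum over `n₁` is replaced by the truncation of
its asymptotic expansion after order `K`. -/
def remainder (α : Fin (r + 1) → ℝ) (K : ℕ) (s : Fin (r + 1) → ℂ) : ℂ :=
  ∑' x : Index r × ℕ, remainderTerm α K s x

theorem exists_dominated_remainderTerm {α : Fin (r + 1) → ℝ} (hα : ∀ j, 0 ≤ α j ∧ α j < 1) {K : ℕ}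
    {s₀ : Fin (r + 1) → ℂ} (hs : s₀ ∈ extendedDomain (r + 1) K) :
    ∃ ε > 0, ∃ M : Index r × ℕ → ℝ, Summable M ∧
      ∀ x, ∀ s ∈ Metric.ball s₀ ε, ‖remainderTerm α K s x‖ ≤ M x := by
  have hα' := tail_mem_Ico hα
  obtain ⟨ε, hε, σ, hσ, hle⟩ := exists_lower_point hs
  obtain ⟨C, hC0, hC⟩ := exists_norm_tailDefect_le (shiftGap α) (shiftGap_mem hα).1
    (shiftGap_mem hα).2 K (‖s₀ 0‖ + ε + 1)
  refine ⟨ε, hε, _, (summable_lead hα' (first_re_gt hσ) (summable_norm_zetaTerm hα'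
    (shiftMap_mem le_rfl hσ))).mul_left C, ?_⟩
  rintro ⟨n, m⟩ s hs
  have hb : 1 ≤ leadBase (Fin.tail α) n + m := by
    have := one_le_leadBase hα' n
    have : (0 : ℝ) ≤ m := m.cast_nonneg
    linarith
  have hnorm : ‖s 0 - 1‖ ≤ ‖s₀ 0‖ + ε + 1 := by
    have h1 : ‖s 0 - s₀ 0‖ ≤ ‖s - s₀‖ := norm_le_pi_norm (s - s₀) 0
    have h2 : ‖s - s₀‖ < ε := by rwa [mem_ball_iff_norm] at hs
    calc ‖s 0 - 1‖ = ‖s₀ 0 + (s 0 - s₀ 0) - 1‖ := by ring_nf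
      _ ≤ ‖s₀ 0‖ + ‖s 0 - s₀ 0‖ + ‖(1 : ℂ)‖ := (norm_sub_le _ _).trans
          (by gcongr; exact norm_add_le _ _)
      _ ≤ _ := by rw [norm_one]; linarith
  rw [remainderTerm, norm_mul, ← mul_assoc]
  refine mul_le_mul ?_ (norm_zetaTerm_le hα' (fun j => hle s hs j.succ) n) (norm_nonneg _)
    (by positivity)
  refine (hC _ hnorm _ hb).trans (mul_le_mul_of_nonneg_left ?_ hC0)
  apply Real.rpow_le_rpow_of_exponent_le hb
  have := hle s hs 0
  simp only [Complex.sub_re, Complex.one_re]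
  linarith

theorem summable_remainderTerm {α : Fin (r + 1) → ℝ} (hα : ∀ j, 0 ≤ α j ∧ α j < 1) {K : ℕ}
    {s : Fin (r + 1) → ℂ} (hs : s ∈ extendedDomain (r + 1) K) :
    Summable (remainderTerm α K s) := by
  obtain ⟨ε, hε, M, hM, hle⟩ := exists_dominated_remainderTerm hα hs
  exact Summable.of_norm_bounded hM fun x => hle x s (Metric.mem_ball_self hε)

theorem analyticAt_remainder {α : Fin (r + 1) → ℝ} (hα : ∀ j, 0 ≤ α j ∧ α j < 1) {K : ℕ}
    {s₀ : Fin (r + 1) → ℂ} (hs : s₀ ∈ extendedDomain (r + 1) K) :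
    AnalyticAt ℂ (remainder α K) s₀ := by
  have hα' := tail_mem_Ico hα
  obtain ⟨ε, hε, M, hM, hle⟩ := exists_dominated_remainderTerm hα hs
  refine analyticAt_tsum_of_ball hε hM (fun x s _ => ?_) hle
  have hb : 0 < leadBase (Fin.tail α) x.1 + x.2 := by
    have := one_le_leadBase hα' x.1
    positivity
  refine AnalyticAt.mul ?_ ?_
  · exact (analyticAt_tailDefect (shiftGap_mem hα).2 K hb (s 0 - 1)).comp
      (f := fun s : Fin (r + 1) → ℂ => s 0 - 1)
      ((analyticAt_coord 0 s).sub analyticAt_const)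
  · refine (analyticAt_zetaTerm hα' x.1 (Fin.tail s)).comp (f := fun s : Fin (r + 1) → ℂ =>
      Fin.tail s) ?_
    exact AnalyticAt.pi fun j => analyticAt_coord j.succ s

theorem remainder_of_eq_one (α : Fin (r + 1) → ℝ) (K : ℕ) {s : Fin (r + 1) → ℂ} (hs : s 0 = 1) :
    remainder α K s = 0 := by
  simp [remainder, remainderTerm, hs, tailDefect_zero]

/-- The expansion of the series of depth `r + 1` in terms of series of depth `r`. -/
theorem hasSum_zetaTerm_succ {α : Fin (r + 1) → ℝ} (hα : ∀ j, 0 ≤ α j ∧ α j < 1) (K : ℕ)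
    {s : Fin (r + 1) → ℂ} (hs : s ∈ convergenceDomain (r + 1)) {Z : ℕ → ℂ}
    (hZ : ∀ j, HasSum (zetaTerm (Fin.tail α) (shiftMap j s)) (Z j)) :
    HasSum (fun n => (s 0 - 1) * zetaTerm α s n)
      (∑ j ∈ Finset.range (K + 1), tailCoeff (shiftGap α) j (s 0 - 1) * Z j +
        remainder α K s) := by
  have hα' := tail_mem_Ico hα
  have hS : Summable fun n => (s 0 - 1) * zetaTerm α s n :=
    (summable_norm_zetaTerm hα hs).of_norm.mul_left _
  have hre : 0 < (s 0 - 1).re := by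
    have := first_re_gt (K := 0) (by rwa [← convergenceDomain_eq])
    simp at this ⊢
    linarith
  have h1 := (indexEquiv r).hasSum_iff.2 hS.hasSum
  have hR := (summable_remainderTerm hα (convergenceDomain_subset _ K hs)).hasSum
  let g₁ : Index r → ℂ := fun n => tailExpansion (shiftGap α) K (s 0 - 1)
    (leadBase (Fin.tail α) n) * zetaTerm (Fin.tail α) (Fin.tail s) n
  let g₂ : Index r → ℂ := fun n => (∑' m : ℕ, tailDefect (shiftGap α) K (s 0 - 1)
    (leadBase (Fin.tail α) n + m)) * zetaTerm (Fin.tail α) (Fin.tail s) n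
  have h2 : HasSum (fun n => g₁ n + g₂ n) (∑' n, (s 0 - 1) * zetaTerm α s n) := by
    refine h1.prod_fiberwise fun n => ?_
    have := (hasSum_tail (shiftGap_mem hα).1 (shiftGap_mem hα).2 K hre
      (one_le_leadBase hα' n)).mul_right (zetaTerm (Fin.tail α) (Fin.tail s) n)
    simp only [g₁, g₂, ← add_mul]
    refine this.congr_fun fun m => ?_
    simp only [Function.comp, zetaTerm_indexEquiv]
    rw [show -(s 0 - 1) - 1 = -s 0 by ring]
    ring
  have h3 : HasSum g₁ (∑ j ∈ Finset.range (K + 1), tailCoeff (shiftGap α) j (s 0 - 1) * Z j) := by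
    refine (hasSum_sum fun j _ => (hZ j).mul_left (tailCoeff (shiftGap α) j (s 0 - 1))).congr_fun
      fun n => ?_
    simp only [g₁, tailExpansion, Finset.sum_mul, zetaTerm_shiftMap hα', mul_assoc]
  have h4 : HasSum g₂ (remainder α K s) := by
    refine hR.prod_fiberwise fun n => ?_
    have hre0 : -(K : ℝ) < (s 0 - 1).re := by
      have : (0 : ℝ) ≤ K := K.cast_nonneg
      linarith
    have := (summable_tailDefect (shiftGap_mem hα).1 (shiftGap_mem hα).2 K hre0
      (one_le_leadBase hα' n)).hasSum.mul_right (zetaTerm (Fin.tail α) (Fin.tail s) n)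
    simpa only [remainderTerm, g₂] using this
  rw [(h3.add h4).unique h2]
  exact hS.hasSum

end Peeling

/-! ### The recursion on the depth and the meromorphic continuation -/

section Continuation

variable {r : ℕ}

theorem analyticAt_shiftMap (j : ℕ) (p : Fin (r + 1) → ℂ) : AnalyticAt ℂ (shiftMap j) p := by
  refine AnalyticAt.pi fun i => (analyticAt_coord i.succ p).add ?_
  split_ifs
  · exact ((analyticAt_coord 0 p).sub analyticAt_const).add analyticAt_const
  · exact analyticAt_const

/-- A section of `shiftMap j`, with first coordinate `c`. -/
def shiftSection (j : ℕ) (c : ℂ) (u : Fin r → ℂ) : Fin (r + 1) → ℂ :=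
  Fin.cons c fun i => u i - if i.val = 0 then c - 1 + j else 0

theorem continuous_shiftSection (j : ℕ) (c : ℂ) :
    Continuous (shiftSection j c : (Fin r → ℂ) → _) := by
  refine continuous_pi fun i => ?_
  cases i using Fin.cases with
  | zero => exact continuous_const
  | succ i => exact (continuous_apply i).sub continuous_const

theorem shiftMap_shiftSection (j : ℕ) (c : ℂ) (u : Fin r → ℂ) :
    shiftMap j (shiftSection j c u) = u := by
  ext i; simp [shiftMap, shiftSection]

theorem shiftSection_shiftMap (j : ℕ) (p : Fin (r + 1) → ℂ) :
    shiftSection j (p 0) (shiftMap j p) = p := by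
  ext i
  cases i using Fin.cases with
  | zero => simp [shiftSection]
  | succ i => simp [shiftMap, shiftSection]

theorem IsMeromorphicAt.comp_shiftMap {F : (Fin r → ℂ) → ℂ} {j : ℕ} {p : Fin (r + 1) → ℂ}
    (hF : IsMeromorphicAt F (shiftMap j p)) : IsMeromorphicAt (fun s => F (shiftMap j s)) p :=
  hF.comp (analyticAt_shiftMap j p) (continuous_shiftSection j (p 0)).continuousAt
    (shiftSection_shiftMap j p) (shiftMap_shiftSection j (p 0))

theorem HasValueAt.comp_shiftMap {F : (Fin r → ℂ) → ℂ} {j : ℕ} {p : Fin (r + 1) → ℂ} {v : ℂ}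
    (hF : HasValueAt F (shiftMap j p) v) : HasValueAt (fun s => F (shiftMap j s)) p v :=
  hF.comp (analyticAt_shiftMap j p) (continuous_shiftSection j (p 0)).continuousAt
    (shiftSection_shiftMap j p) (shiftMap_shiftSection j (p 0))

theorem nonzeroGerm_first_sub_one (p : Fin (r + 1) → ℂ) : NonzeroGerm (fun s => s 0 - 1) p := by
  refine ⟨(analyticAt_coord 0 p).sub analyticAt_const, ?_⟩
  have h := mem_closure_iff_frequently.1 (dense_compl_singleton (1 : ℂ) (p 0))
  rw [← (isOpenMap_eval (X := fun _ : Fin (r + 1) => ℂ) 0).map_nhds_eq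
    (continuous_apply 0).continuousAt, frequently_map] at h
  exact h.mono fun s hs => sub_ne_zero.2 hs

theorem isMeromorphicContinuation_zeta {α : Fin r → ℝ} (h : ∃ F, IsMeromorphicContinuation α F) :
    IsMeromorphicContinuation α (zeta α) := by
  rw [zeta, dif_pos h]
  exact h.choose_spec

/-- The numerator of the expression of `ζ_{r+1}` through `ζ_r`. -/
def peeledNumerator (α : Fin (r + 1) → ℝ) (K : ℕ) (s : Fin (r + 1) → ℂ) : ℂ :=
  ∑ j ∈ Finset.range (K + 1),
    tailCoeff (shiftGap α) j (s 0 - 1) * zeta (Fin.tail α) (shiftMap j s) + remainder α K s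

theorem analyticAt_tailCoeff_first (b : ℝ) (j : ℕ) (p : Fin (r + 1) → ℂ) :
    AnalyticAt ℂ (fun s : Fin (r + 1) → ℂ => tailCoeff b j (s 0 - 1)) p :=
  (analyticAt_tailCoeff b j (p 0 - 1)).comp (f := fun s : Fin (r + 1) → ℂ => s 0 - 1)
    ((analyticAt_coord 0 p).sub analyticAt_const)

theorem isMeromorphicAt_peeled {α : Fin (r + 1) → ℝ} (hα : ∀ j, 0 ≤ α j ∧ α j < 1)
    (hC : IsMeromorphicContinuation (Fin.tail α) (zeta (Fin.tail α))) {K : ℕ}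
    {p : Fin (r + 1) → ℂ} (hp : p ∈ extendedDomain (r + 1) K) :
    IsMeromorphicAt (fun s => peeledNumerator α K s / (s 0 - 1)) p := by
  refine IsMeromorphicAt.div_nonzeroGerm (.add (.sum fun j _ => .mul ?_ ?_) ?_)
    (nonzeroGerm_first_sub_one p)
  · exact AnalyticAt.isMeromorphicAt (analyticAt_tailCoeff_first _ j p)
  · exact IsMeromorphicAt.comp_shiftMap (hC.1 _)
  · exact AnalyticAt.isMeromorphicAt (analyticAt_remainder hα hp)

theorem hasSum_peeled {α : Fin (r + 1) → ℝ} (hα : ∀ j, 0 ≤ α j ∧ α j < 1)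
    (hC : IsMeromorphicContinuation (Fin.tail α) (zeta (Fin.tail α))) (K : ℕ)
    {s : Fin (r + 1) → ℂ} (hs : s ∈ convergenceDomain (r + 1)) :
    HasSum (zetaTerm α s) (peeledNumerator α K s / (s 0 - 1)) := by
  have h0 : s 0 - 1 ≠ 0 := by
    have h1 := first_re_gt (K := 0) (by rwa [← convergenceDomain_eq])
    intro h
    have := congr_arg Complex.re h
    simp at this h1
    linarith
  have h := hasSum_zetaTerm_succ hα K hs (Z := fun j => zeta (Fin.tail α) (shiftMap j s))
    fun j => hC.2 _ (shiftMap_mem (Nat.zero_le j) (by rwa [← convergenceDomain_eq]))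
  have h2 := h.div_const (s 0 - 1)
  simp only [mul_div_cancel_left₀ _ h0] at h2
  exact h2

/-- The multiple Hurwitz zeta function has a meromorphic continuation. -/
theorem isMeromorphicContinuation_zeta_of_mem_Ico : ∀ {r : ℕ} {α : Fin r → ℝ},
    (∀ j, 0 ≤ α j ∧ α j < 1) → IsMeromorphicContinuation α (zeta α) := by
  intro r
  induction r with
  | zero =>
    intro α _
    refine isMeromorphicContinuation_zeta ⟨fun _ => 1, fun p =>
      AnalyticAt.isMeromorphicAt analyticAt_const, fun s _ => ?_⟩
    have : Unique (Index 0) := ⟨⟨⟨Fin.elim0, fun i => i.elim0, fun i => i.elim0⟩⟩,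
      fun n => Subsingleton.elim _ _⟩
    convert! hasSum_unique (zetaTerm α s)
    simp [zetaTerm]
  | succ r ih =>
    intro α hα
    have hC := ih (tail_mem_Ico hα)
    refine isMeromorphicContinuation_zeta ?_
    have hmer : ∀ K, ∀ p ∈ extendedDomain (r + 1) K,
        IsMeromorphicAt (fun s => peeledNumerator α K s / (s 0 - 1)) p :=
      fun K p hp => isMeromorphicAt_peeled hα hC hp
    obtain ⟨q, hq⟩ := convergenceDomain_nonempty (r + 1)
    have hopen : ∀ s ∈ convergenceDomain (r + 1), ∀ᶠ z in 𝓝 s, z ∈ convergenceDomain (r + 1) := by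
      intro s hs
      rw [convergenceDomain_eq] at hs ⊢
      exact (isOpen_extendedDomain _ _).mem_nhds hs
    -- all truncations agree, since they agree on the domain of convergence
    have hcompat : ∀ K K', ∀ p ∈ extendedDomain (r + 1) K, p ∈ extendedDomain (r + 1) K' →
        MeroEqAt (fun s => peeledNumerator α K s / (s 0 - 1))
          (fun s => peeledNumerator α K' s / (s 0 - 1)) p := by
      intro K K' p hp hp'
      refine MeroEqAt.of_isPreconnected ((convex_extendedDomain (r + 1) K).inter
        (convex_extendedDomain (r + 1) K')).isPreconnected (fun p hp => hmer K p hp.1)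
        (fun p hp => hmer K' p hp.2) (p₀ := q)
        ⟨convergenceDomain_subset _ K hq, convergenceDomain_subset _ K' hq⟩ ?_ p ⟨hp, hp'⟩
      refine .of_eventuallyEq ?_
      filter_upwards [hopen q hq] with s hs
      exact (hasSum_peeled hα hC K hs).unique (hasSum_peeled hα hC K' hs)
    obtain ⟨G, hG, hGv⟩ := exists_glued (fun K => isOpen_extendedDomain (r + 1) K)
      exists_mem_extendedDomain hmer hcompat
    refine ⟨G, hG, fun s hs => ?_⟩
    have h0 := hasSum_peeled hα hC 0 hs
    have hv : HasValueAt (fun s => peeledNumerator α 0 s / (s 0 - 1)) s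
        (∑' n, zetaTerm α s n) := by
      refine (HasValueAt.of_analyticAt (analyticAt_tsum_zetaTerm hα hs)).congr
        (.of_eventuallyEq ?_)
      filter_upwards [hopen s hs] with z hz
      exact (hasSum_peeled hα hC 0 hz).tsum_eq.symm
    rw [hGv 0 s (convergenceDomain_subset _ 0 hs) _ hv]
    exact h0.summable.hasSum

theorem meroEqAt_zeta_peeled {α : Fin (r + 1) → ℝ} (hα : ∀ j, 0 ≤ α j ∧ α j < 1) {K : ℕ}
    {p : Fin (r + 1) → ℂ} (hp : p ∈ extendedDomain (r + 1) K) :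
    MeroEqAt (fun s => (s 0 - 1) * zeta α s) (peeledNumerator α K) p := by
  have hC := isMeromorphicContinuation_zeta_of_mem_Ico (tail_mem_Ico hα)
  have hC' := isMeromorphicContinuation_zeta_of_mem_Ico hα
  obtain ⟨q, hq⟩ := convergenceDomain_nonempty (r + 1)
  have h1 : MeroEqAt (zeta α) (fun s => peeledNumerator α K s / (s 0 - 1)) p := by
    refine MeroEqAt.of_isPreconnected (convex_extendedDomain (r + 1) K).isPreconnected
      (fun p _ => hC'.1 p) (fun p hp => isMeromorphicAt_peeled hα hC hp)
      (convergenceDomain_subset _ K hq) (.of_eventuallyEq ?_) p hp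
    have hq' : q ∈ extendedDomain (r + 1) 0 := by rwa [← convergenceDomain_eq]
    filter_upwards [(isOpen_extendedDomain _ _).mem_nhds hq'] with s hs
    rw [← convergenceDomain_eq] at hs
    exact (hC'.2 s hs).unique (hasSum_peeled hα hC K hs)
  refine ((MeroEqAt.refl (fun s => s 0 - 1) p).mul h1).trans ?_
  have hn := nonzeroGerm_first_sub_one p
  exact ⟨_, hn.1, hn.2, .of_forall fun s hs => mul_div_cancel₀ _ hs⟩

/-- The value at `p` of `(s₁ - 1) L(s) ζ_{r+1}(s)`, for a holomorphic factor `L` which removes the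
poles of the functions of depth `r`. -/
theorem hasValueAt_mul_zeta {α : Fin (r + 1) → ℝ} (hα : ∀ j, 0 ≤ α j ∧ α j < 1) {K : ℕ}
    {p : Fin (r + 1) → ℂ} (hp : p ∈ extendedDomain (r + 1) K) {L : (Fin (r + 1) → ℂ) → ℂ}
    (hL : AnalyticAt ℂ L p) {v : ℕ → ℂ}
    (hv : ∀ j, HasValueAt (fun s => L s * zeta (Fin.tail α) (shiftMap j s)) p (v j)) :
    HasValueAt (fun s => (s 0 - 1) * (L s * zeta α s)) p
      (∑ j ∈ Finset.range (K + 1), tailCoeff (shiftGap α) j (p 0 - 1) * v j +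
        L p * remainder α K p) := by
  have h1 : HasValueAt (fun s => ∑ j ∈ Finset.range (K + 1), tailCoeff (shiftGap α) j (s 0 - 1) *
      (L s * zeta (Fin.tail α) (shiftMap j s)) + L s * remainder α K s) p
      (∑ j ∈ Finset.range (K + 1), tailCoeff (shiftGap α) j (p 0 - 1) * v j +
        L p * remainder α K p) := by
    refine HasValueAt.add (HasValueAt.sum fun j _ => ?_)
      (.of_analyticAt (hL.mul (analyticAt_remainder hα hp)))
    exact (HasValueAt.of_analyticAt (analyticAt_tailCoeff_first _ j p)).mul (hv j)
  refine h1.congr ?_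
  have h2 := (MeroEqAt.refl L p).mul (meroEqAt_zeta_peeled hα hp)
  convert! h2 using 2 with s s
  · ring
  · rw [peeledNumerator, mul_add, Finset.mul_sum]
    congr 1
    exact Finset.sum_congr rfl fun j _ => by ring

/-- `hasValueAt_mul_zeta` at a point off the hyperplane `s₁ = 1`. -/
theorem hasValueAt_mul_zeta_of_ne {α : Fin (r + 1) → ℝ} (hα : ∀ j, 0 ≤ α j ∧ α j < 1) {K : ℕ}
    {p : Fin (r + 1) → ℂ} (hp : p ∈ extendedDomain (r + 1) K) (hp1 : p 0 - 1 ≠ 0)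
    {L : (Fin (r + 1) → ℂ) → ℂ} (hL : AnalyticAt ℂ L p) {v : ℕ → ℂ}
    (hv : ∀ j, HasValueAt (fun s => L s * zeta (Fin.tail α) (shiftMap j s)) p (v j)) :
    HasValueAt (fun s => L s * zeta α s) p
      ((p 0 - 1)⁻¹ * (∑ j ∈ Finset.range (K + 1), tailCoeff (shiftGap α) j (p 0 - 1) * v j +
        L p * remainder α K p)) := by
  have han : AnalyticAt ℂ (fun s : Fin (r + 1) → ℂ => s 0 - 1) p :=
    (analyticAt_coord 0 p).sub analyticAt_const
  refine ((HasValueAt.of_analyticAt (han.inv hp1)).mul (hasValueAt_mul_zeta hα hp hL hv)).congr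
    (.of_eventuallyEq ?_)
  filter_upwards [han.continuousAt.eventually_ne hp1] with s hs
  exact (inv_mul_cancel_left₀ hs _).symm

end Continuation

/-! ### Residues -/

section Residues

variable {r : ℕ}

/-- `p` lies on none of the hyperplanes `H_{i,k}`, for the given `i`. -/
def AvoidsPoles (p : Fin r → ℂ) (i : ℕ) : Prop := ∀ k : ℕ, partialSum p i ≠ i - k

theorem AvoidsPoles.shiftMap {p : Fin (r + 1) → ℂ} {i : ℕ} (h : AvoidsPoles p (i + 1))
    (hi : 1 ≤ i) (hir : i ≤ r) (j : ℕ) : AvoidsPoles (shiftMap j p) i := by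
  intro k hk
  apply h (j + k)
  rw [partialSum_shiftMap j p hi hir] at hk
  push_cast
  linear_combination hk

theorem partialSum_one (s : Fin (r + 1) → ℂ) : partialSum s 1 = s 0 := by
  rw [partialSum_succ, partialSum_zero, add_zero]

theorem analyticAt_partialSum (m : ℕ) (p : Fin r → ℂ) :
    AnalyticAt ℂ (fun s => partialSum s m) p :=
  Finset.analyticAt_fun_sum _ fun j _ => analyticAt_coord j p

theorem analyticAt_linForm (i k : ℕ) (p : Fin r → ℂ) : AnalyticAt ℂ (linForm r i k) p :=
  ((analyticAt_partialSum i p).sub analyticAt_const).add analyticAt_const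

/-- The zeta function is holomorphic off the hyperplanes `H_{i,k}`. -/
theorem exists_hasValueAt_zeta : ∀ {r : ℕ} {α : Fin r → ℝ}, (∀ j, 0 ≤ α j ∧ α j < 1) →
    ∀ {p : Fin r → ℂ}, (∀ i, 1 ≤ i → i ≤ r → AvoidsPoles p i) → ∃ v, HasValueAt (zeta α) p v := by
  intro r
  induction r with
  | zero =>
    intro α hα p _
    have hC := isMeromorphicContinuation_zeta_of_mem_Ico hα
    have h : zeta α = fun s => ∑' n, zetaTerm α s n := by
      funext s
      exact (hC.2 s fun i h1 h2 => by omega).tsum_eq.symm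
    rw [h]
    exact ⟨_, .of_analyticAt (analyticAt_tsum_zetaTerm hα fun i h1 h2 => by omega)⟩
  | succ r ih =>
    intro α hα p hp
    have hp1 : p 0 - 1 ≠ 0 := by
      have := hp 1 le_rfl (by omega) 0
      rw [partialSum_one] at this
      simpa [sub_eq_zero] using this
    have hv : ∀ j, ∃ v, HasValueAt (zeta (Fin.tail α)) (shiftMap j p) v := fun j =>
      ih (tail_mem_Ico hα) fun i h1 h2 => (hp (i + 1) (by omega) (by omega)).shiftMap h1 h2 j
    choose v hv using hv
    obtain ⟨K, hK⟩ := exists_mem_extendedDomain p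
    have := hasValueAt_mul_zeta_of_ne hα hK hp1 (L := fun _ => 1) analyticAt_const (v := v)
      fun j => by simpa using (hv j).comp_shiftMap
    simp only [one_mul] at this
    exact ⟨_, this⟩

theorem mul_bernoulliMatrix_zero (b : ℝ) {t : ℂ} (ht : t ≠ 0) (j : ℕ) :
    t * bernoulliMatrix b t 0 j = tailCoeff b j t := by
  change t * (if j < 0 then 0 else if j = 0 then 1 / (t + (0 : ℕ)) else
    (∏ l ∈ Finset.Ioo 0 j, (t + l)) *
      ((Polynomial.aeval b (Polynomial.bernoulli (j - 0)) : ℝ) : ℂ) / (j - 0).factorial) = _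
  rw [if_neg (Nat.not_lt_zero j), tailCoeff]
  split_ifs with h
  · subst h
    simp [rising, bernoulliCoeff_zero, ht]
  · have : rising t j = t * ∏ l ∈ Finset.Ioo 0 j, (t + l) := by
      rw [rising, Finset.range_eq_Ico, ← Finset.Ioo_insert_left (Nat.pos_of_ne_zero h),
        Finset.prod_insert (by simp)]
      simp
    rw [this, bernoulliCoeff, Nat.sub_zero]
    ring

theorem bernoulliMatrix_apply (b : ℝ) (t : ℂ) (m n : ℕ) : bernoulliMatrix b t m n =
    if n < m then 0 else if n = m then 1 / (t + m)
    else (∏ j ∈ Finset.Ioo m n, (t + j)) *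
      ((Polynomial.aeval b (Polynomial.bernoulli (n - m)) : ℝ) : ℂ) / (n - m).factorial := rfl

/-- Translating the parameter `t` amounts to deleting rows and columns. -/
theorem bernoulliMatrix_add (b : ℝ) (t : ℂ) (x m n : ℕ) :
    bernoulliMatrix b (t + x) m n = bernoulliMatrix b t (m + x) (n + x) := by
  have h : ∏ j ∈ Finset.Ioo (m + x) (n + x), (t + j) = ∏ j ∈ Finset.Ioo m n, (t + x + j) := by
    rw [← Finset.map_add_right_Ioo, Finset.prod_map]
    refine Finset.prod_congr rfl fun j _ => ?_
    simp only [addRightEmbedding_apply]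
    push_cast
    ring
  simp only [bernoulliMatrix_apply, Nat.add_lt_add_iff_right, Nat.add_right_cancel_iff,
    Nat.add_sub_add_right, h]
  congr 2
  push_cast
  ring

theorem prod_ofFn_shift (x : ℕ) : ∀ {N : ℕ} {f g : Fin N → IncidenceAlgebra ℂ ℕ},
    (∀ e m n, f e m n = g e (m + x) (n + x)) → ∀ m n,
      (List.ofFn f).prod m n = (List.ofFn g).prod (m + x) (n + x) := by
  intro N
  induction N with
  | zero => intro f g _ m n; simp [IncidenceAlgebra.one_apply]
  | succ N ih =>
    intro f g h m n
    rw [List.ofFn_succ, List.ofFn_succ, List.prod_cons, List.prod_cons,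
      IncidenceAlgebra.mul_apply, IncidenceAlgebra.mul_apply, ← Finset.map_add_right_Icc,
      Finset.sum_map]
    refine Finset.sum_congr rfl fun l _ => ?_
    rw [h, ih (f := fun e => f e.succ) (g := fun e => g e.succ) fun e m n => h e.succ m n]
    rfl

theorem analyticAt_prod_ofFn {p : Fin r → ℂ} : ∀ {N : ℕ}
    {f : Fin N → (Fin r → ℂ) → IncidenceAlgebra ℂ ℕ},
    (∀ e m n, AnalyticAt ℂ (fun s => f e s m n) p) →
      ∀ m n, AnalyticAt ℂ (fun s => (List.ofFn fun e => f e s).prod m n) p := by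
  intro N
  induction N with
  | zero => intro f _ m n; simpa using analyticAt_const
  | succ N ih =>
    intro f h m n
    simp only [List.ofFn_succ, List.prod_cons, IncidenceAlgebra.mul_apply]
    exact Finset.analyticAt_fun_sum _ fun l _ => (h 0 m l).mul
      (ih (f := fun e => f e.succ) (fun e m n => h e.succ m n) l n)

theorem analyticAt_bernoulliMatrix (b : ℝ) {t : (Fin r → ℂ) → ℂ} {p : Fin r → ℂ}
    (ht : AnalyticAt ℂ t p) (hp : ∀ m : ℕ, t p + m ≠ 0) (m n : ℕ) :
    AnalyticAt ℂ (fun s => bernoulliMatrix b (t s) m n) p := by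
  simp only [bernoulliMatrix_apply]
  split_ifs
  · exact analyticAt_const
  · exact analyticAt_const.div (ht.add analyticAt_const) (hp m)
  · exact ((Finset.analyticAt_fun_prod _ fun j _ => ht.add analyticAt_const).mul
      analyticAt_const).div_const

theorem analyticAt_residueMatrix (α : Fin r → ℝ) {i : ℕ} (hi : i ≤ r) {p : Fin r → ℂ}
    (hp : ∀ d, 1 ≤ d → d < i → AvoidsPoles p d) (k : ℕ) :
    AnalyticAt ℂ (fun s => residueMatrix α i hi s 0 k) p := by
  refine analyticAt_prod_ofFn (fun e m n => analyticAt_bernoulliMatrix _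
    ((analyticAt_partialSum _ p).sub analyticAt_const) (fun m hm => ?_) m n) 0 k
  refine hp (e + 1) (by omega) (by omega) m ?_
  have hm' : partialSum p (e + 1) - ((e : ℕ) + 1) + m = 0 := hm
  push_cast
  linear_combination hm'

/-- Peeling off the first factor of the matrix product. -/
theorem residueMatrix_succ (α : Fin (r + 1) → ℝ) {i : ℕ} (hi1 : 1 ≤ i) (hi : i ≤ r)
    (s : Fin (r + 1) → ℂ) (k : ℕ) :
    residueMatrix α (i + 1) (Nat.succ_le_succ hi) s 0 k =
      ∑ x ∈ Finset.range (k + 1), bernoulliMatrix (shiftGap α) (s 0 - 1) 0 x *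
        residueMatrix (Fin.tail α) i hi (shiftMap x s) 0 (k - x) := by
  obtain ⟨i, rfl⟩ := Nat.exists_eq_add_of_le' hi1
  have h1 : residueMatrix α (i + 1 + 1) (Nat.succ_le_succ hi) s =
      (List.ofFn fun e : Fin (i + 1) =>
        bernoulliMatrix (α ⟨e + 1, by omega⟩ - α ⟨e, by omega⟩)
          (partialSum s (e + 1) - ((e : ℕ) + 1 : ℂ))).prod := rfl
  rw [h1, List.ofFn_succ, List.prod_cons, IncidenceAlgebra.mul_apply,
    show Finset.Icc 0 k = Finset.range (k + 1) by ext; simp]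
  refine Finset.sum_congr rfl fun x hx => ?_
  have hx := Finset.mem_range.1 hx
  congr 1
  · have hs : shiftGap α = α ⟨1, by omega⟩ - α ⟨0, by omega⟩ := by
      rw [shiftGap, leadShift, dif_pos (by omega)]
      rfl
    rw [hs]
    simp [partialSum_one]
  · have h2 : residueMatrix (Fin.tail α) (i + 1) hi (shiftMap x s) =
      (List.ofFn fun e : Fin i =>
        bernoulliMatrix (Fin.tail α ⟨e + 1, by omega⟩ - Fin.tail α ⟨e, by omega⟩)
          (partialSum (shiftMap x s) (e + 1) - ((e : ℕ) + 1 : ℂ))).prod := rfl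
    rw [h2, prod_ofFn_shift x (f := _) (g := fun e : Fin i =>
        bernoulliMatrix (α ⟨e.succ + 1, by simp; omega⟩ - α ⟨e.succ, by simp; omega⟩)
          (partialSum s (e.succ + 1) - ((e.succ : ℕ) + 1 : ℂ))) ?_ 0 (k - x)]
    · rw [zero_add, Nat.sub_add_cancel (by omega)]
    · intro e m n
      have ht : partialSum (shiftMap x s) (e + 1) - ((e : ℕ) + 1 : ℂ) =
          partialSum s (e.succ + 1) - ((e.succ : ℕ) + 1 : ℂ) + x := by
        rw [partialSum_shiftMap x s (by omega) (by omega)]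
        simp only [Fin.val_succ]
        push_cast
        ring
      rw [← bernoulliMatrix_add, ht]
      rfl

/-- Equality of zeta functions whose depths are equal but not definitionally so. -/
theorem zeta_congr {m m' : ℕ} (h : m = m') {α : Fin m → ℝ} {α' : Fin m' → ℝ}
    {p : Fin m → ℂ} {p' : Fin m' → ℂ} (hα : ∀ j, α j = α' (Fin.cast h j))
    (hp : ∀ j, p j = p' (Fin.cast h j)) {w : ℂ} (hw : HasValueAt (zeta α') p' w) :
    HasValueAt (zeta α) p w := by
  subst h
  obtain rfl : α = α' := funext hα
  obtain rfl : p = p' := funext hp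
  exact hw

/-- The value of `(s₁ + ⋯ + s_i - i + k) ζ_r` at a point of `H_{i,k}` which lies on no `H_{i',k'}`
with `i' ≠ i`. -/
theorem hasValueAt_linForm_mul_zeta : ∀ {r : ℕ} {α : Fin r → ℝ}, (∀ j, 0 ≤ α j ∧ α j < 1) →
    ∀ {i k : ℕ} (_ : 1 ≤ i) (hi : i ≤ r) {p : Fin r → ℂ}, partialSum p i = i - k →
    (∀ i', 1 ≤ i' → i' ≤ r → i' ≠ i → AvoidsPoles p i') →
    ∀ {w : ℂ}, HasValueAt (zeta (dropFirst i α)) (dropFirst i p) w →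
      HasValueAt (fun s => linForm r i k s * zeta α s) p (w * residueMatrix α i hi p 0 k) := by
  intro r
  induction r with
  | zero => intro α _ i k h1 h2; omega
  | succ r ih =>
    intro α hα i k hi1 hi p hpi hp w hw
    have hα' := tail_mem_Ico hα
    obtain ⟨K₀, hK₀⟩ := exists_mem_extendedDomain p
    have hK := extendedDomain_mono (Nat.le_add_right K₀ k) hK₀
    obtain rfl | hi2 := hi1.eq_or_lt
    · -- the first hyperplanes: only `k = 0` gives a pole
      have hv : ∀ j, ∃ v, HasValueAt (zeta (Fin.tail α)) (shiftMap j p) v := fun j =>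
        exists_hasValueAt_zeta hα' fun i h1 h2 =>
          (hp (i + 1) (by omega) (by omega) (by omega)).shiftMap h1 h2 j
      choose v hv using hv
      rw [partialSum_one] at hpi
      have hres : residueMatrix α 1 hi p 0 k = if k = 0 then 1 else 0 := by
        change (1 : IncidenceAlgebra ℂ ℕ) 0 k = _
        simp [IncidenceAlgebra.one_apply, eq_comm]
      rw [hres]
      split_ifs with hk
      · subst hk
        have hp0 : p 0 = 1 := by simpa using hpi
        have h := hasValueAt_mul_zeta hα hK (L := fun _ => 1) analyticAt_const (v := v)
          fun j => by simpa using (hv j).comp_shiftMap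
        have hvw : v 0 = w := by
          refine (hv 0).unique (zeta_congr (by omega) (fun j => ?_) (fun j => ?_) hw)
          · exact congr_arg α (Fin.ext (by simp; omega))
          · simp only [shiftMap, hp0, Nat.cast_zero, sub_self, add_zero, ite_self]
            exact congr_arg p (Fin.ext (by simp; omega))
        rw [remainder_of_eq_one α _ hp0, hp0, sub_self] at h
        simp only [tailCoeff_zero_apply, ite_mul, one_mul, zero_mul, mul_zero, add_zero,
          Finset.sum_ite_eq', Finset.mem_range, Nat.succ_pos, if_true, hvw] at h
        simpa [linForm, partialSum_one] using h
      · have hp1 : p 0 - 1 ≠ 0 := by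
          rw [hpi]
          simpa using hk
        have h := (HasValueAt.of_analyticAt (analyticAt_linForm (r := r + 1) 1 k p)).mul
          (hasValueAt_mul_zeta_of_ne hα hK hp1 (L := fun _ => 1) analyticAt_const (v := v)
            fun j => by simpa using (hv j).comp_shiftMap)
        have h0 : linForm (r + 1) 1 k p = 0 := by
          rw [linForm, partialSum_one, hpi]; ring
        rw [h0, zero_mul] at h
        simpa using h
    · obtain ⟨i, rfl⟩ := Nat.exists_eq_add_of_le' hi1
      have hi1' : 1 ≤ i := by omega
      have hir : i ≤ r := by omega
      have hp1 : p 0 - 1 ≠ 0 := by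
        have := hp 1 le_rfl (by omega) (by omega) 0
        rw [partialSum_one] at this
        simpa [sub_eq_zero] using this
      have hL0 : linForm (r + 1) (i + 1) k p = 0 := by rw [linForm, hpi]; ring
      have hpj : ∀ j i', 1 ≤ i' → i' ≤ r → i' ≠ i → AvoidsPoles (shiftMap j p) i' :=
        fun j i' h1 h2 h3 =>
          (hp (i' + 1) (by omega) (by omega) (by omega)).shiftMap h1 h2 j
      have hpij : ∀ j : ℕ, partialSum (shiftMap j p) i = i - k + j := by
        intro j
        rw [partialSum_shiftMap j p hi1' hir, hpi]
        push_cast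
        ring
      have hv : ∀ j, HasValueAt
          (fun s => linForm (r + 1) (i + 1) k s * zeta (Fin.tail α) (shiftMap j s)) p
          (if j ≤ k then w * residueMatrix (Fin.tail α) i hir (shiftMap j p) 0 (k - j) else 0) := by
        intro j
        split_ifs with hjk
        · have h1 := ih hα' (k := k - j) hi1' hir (p := shiftMap j p)
            (by rw [hpij]; push_cast [hjk]; ring) (hpj j) (w := w) ?_
          · refine h1.comp_shiftMap.congr (.of_eventuallyEq (.of_forall fun s => ?_))
            simp only [linForm, partialSum_shiftMap j s hi1' hir]
            push_cast [hjk]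
            ring
          · refine zeta_congr (by omega) (fun l => ?_) (fun l => ?_) hw
            · exact congr_arg α (Fin.ext (by simp; omega))
            · simp only [dropFirst, shiftMap]
              rw [if_neg (by omega), add_zero]
              exact congr_arg p (Fin.ext (by simp; omega))
        · obtain ⟨v, hv⟩ := exists_hasValueAt_zeta hα' (p := shiftMap j p) fun i' h1 h2 => by
            by_cases h3 : i' = i
            · subst h3
              intro l hl
              rw [hpij] at hl
              have : ((j + l : ℕ) : ℂ) = (k : ℂ) := by push_cast; linear_combination hl
              have : j + l = k := by exact_mod_cast this
              omega
            · exact hpj j i' h1 h2 h3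
          have h := (HasValueAt.of_analyticAt
            (analyticAt_linForm (r := r + 1) (i + 1) k p)).mul hv.comp_shiftMap
          rwa [hL0, zero_mul] at h
      have h := hasValueAt_mul_zeta_of_ne hα hK hp1 (analyticAt_linForm (i + 1) k p) hv
      convert h using 1
      rw [hL0, zero_mul, add_zero, residueMatrix_succ α hi1' hir,
        ← Finset.sum_subset (Finset.range_mono (by omega : k + 1 ≤ K₀ + k + 1))
          (fun j _ hj => by
            rw [if_neg (by simpa [Nat.lt_succ_iff] using hj), mul_zero]),
        Finset.mul_sum, Finset.mul_sum]
      refine Finset.sum_congr rfl fun j hj => ?_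
      rw [if_pos (Nat.lt_succ_iff.1 (Finset.mem_range.1 hj)), ← mul_bernoulliMatrix_zero _ hp1 j]
      field_simp

/-- The map `dropFirst i` is holomorphic with continuous sections, so values pull back along it. -/
theorem HasValueAt.comp_dropFirst {i : ℕ} {F : (Fin (r - i) → ℂ) → ℂ} {p : Fin r → ℂ} {v : ℂ}
    (hF : HasValueAt F (dropFirst i p) v) : HasValueAt (fun s => F (dropFirst i s)) p v := by
  let σ : (Fin (r - i) → ℂ) → (Fin r → ℂ) :=
    fun u j => if h : i ≤ j.val then u ⟨j - i, by omega⟩ else p j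
  refine hF.comp (σ := σ) (AnalyticAt.pi fun j => analyticAt_coord _ p) ?_ ?_ ?_
  · refine (continuous_pi fun j => ?_).continuousAt
    simp only [σ]
    split_ifs
    · exact continuous_apply _
    · exact continuous_const
  · ext j
    simp only [σ, dropFirst]
    split_ifs with h
    · exact congr_arg p (Fin.ext (Nat.add_sub_of_le h))
    · rfl
  · intro u
    ext j
    simp [σ, dropFirst]

theorem partialSum_dropFirst (s : Fin r → ℂ) {i m : ℕ} (him : i + m ≤ r) :
    partialSum (dropFirst i s) m = partialSum s (i + m) - partialSum s i := by
  have key : ∀ {r : ℕ} (s : Fin r → ℂ) {m : ℕ} (hm : m ≤ r),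
      partialSum s m = ∑ l : Fin m, s (Fin.castLE hm l) := by
    intro r
    induction r with
    | zero =>
      intro s m hm
      obtain rfl := Nat.le_zero.1 hm
      simp [partialSum]
    | succ r ih =>
      intro s m hm
      cases m with
      | zero => simp [partialSum]
      | succ m =>
        rw [partialSum_succ, ih (Fin.tail s) (Nat.le_of_succ_le_succ hm), Fin.sum_univ_succ]
        rfl
  rw [key _ (by omega : m ≤ r - i), key s him, key s (by omega : i ≤ r), Fin.sum_univ_add]
  have e : ∑ l : Fin i, s (Fin.castLE him (Fin.castAdd m l)) =
      ∑ l : Fin i, s (Fin.castLE (by omega) l) := rfl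
  rw [e, add_sub_cancel_left]
  rfl

theorem AvoidsPoles.dropFirst {p : Fin r → ℂ} {i k m : ℕ} (hp : partialSum p i = i - k)
    (him : i + m ≤ r) (h : AvoidsPoles p (i + m)) : AvoidsPoles (dropFirst i p) m := by
  intro l hl
  apply h (k + l)
  rw [partialSum_dropFirst p him, hp] at hl
  push_cast
  linear_combination hl

theorem partialSum_telescope : ∀ {r : ℕ} (c : ℕ → ℂ) {m : ℕ}, m ≤ r →
    partialSum (fun j : Fin r => c (j + 1) - c j) m = c m - c 0 := by
  intro r
  induction r with
  | zero =>
    intro c m hm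
    obtain rfl := Nat.le_zero.1 hm
    simp [partialSum]
  | succ r ih =>
    intro c m hm
    cases m with
    | zero => simp [partialSum]
    | succ m =>
      rw [partialSum_succ]
      have : Fin.tail (fun j : Fin (r + 1) => c (j + 1) - c j) =
          fun j : Fin r => c (j + 1 + 1) - c (j + 1) := by
        funext j; simp [Fin.tail]
      rw [this, ih (fun l => c (l + 1)) (Nat.le_of_succ_le_succ hm)]
      simp

/-- The points of `H_{i,k}` which lie on no `H_{i',k'}` with `i' ≠ i`. -/
def genericPoints (r i k : ℕ) : Set (Fin r → ℂ) :=
  {p | p ∈ hyperplane r i k ∧ ∀ i', 1 ≤ i' → i' ≤ r → i' ≠ i → AvoidsPoles p i'}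

theorem hyperplane_subset_closure {i k : ℕ} (hir : i ≤ r) :
    hyperplane r i k ⊆ closure (genericPoints r i k) := by
  intro p hp
  -- moving along `v` fixes the `i`-th partial sum and translates all others
  let c : ℕ → ℂ := fun m => if m = i ∨ m = 0 then 0 else 1
  let v : Fin r → ℂ := fun j => c (j + 1) - c j
  have hv : ∀ m, m ≤ r → partialSum v m = c m := fun m hm => by
    rw [partialSum_telescope c hm]; simp [c]
  have hadd : ∀ (ε : ℂ) (m : ℕ), partialSum (fun j => p j + ε * v j) m =
      partialSum p m + ε * partialSum v m := fun ε m => by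
    simp [partialSum, Finset.sum_add_distrib, Finset.mul_sum]
  let bad : Set ℂ := Set.range fun x : ℕ × ℕ => (x.1 : ℂ) - x.2 - partialSum p x.1
  have hdense : (0 : ℂ) ∈ closure badᶜ := (Set.countable_range _).dense_compl ℂ 0
  have hcont : Continuous fun ε : ℂ => (fun j => p j + ε * v j : Fin r → ℂ) := by fun_prop
  have h := map_mem_closure hcont hdense (t := genericPoints r i k) ?_
  · simpa using h
  · intro ε hε
    refine ⟨?_, fun i' h1 h2 h3 k' hk' => hε ⟨(i', k'), ?_⟩⟩
    · change partialSum _ i = _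
      rw [hadd, hv i hir]
      have hp' : partialSum p i = i - k := hp
      simpa [c] using hp'
    · rw [hadd, hv i' h2] at hk'
      have : c i' = 1 := by simp [c, h3]; omega
      rw [this] at hk'
      simp only
      linear_combination -hk'

/-- The residue formula. For `i = 1` the matrix product is empty, so its `(0, k)` entry is `1` for
`k = 0` and `0` otherwise. -/
theorem residueEq_zeta {α : Fin r → ℝ} (hα : ∀ j, 0 ≤ α j ∧ α j < 1) {i k : ℕ} (hi1 : 1 ≤ i)
    (hi : i ≤ r) :
    ResidueEq i k (zeta α)
      (fun s => zeta (dropFirst i α) (dropFirst i s) * residueMatrix α i hi s 0 k) := by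
  refine SameRestriction.of_dense (fun p hp => hp.1) (hyperplane_subset_closure hi) ?_
  rintro p ⟨hpi, hp⟩
  obtain ⟨w, hw⟩ := exists_hasValueAt_zeta (α := dropFirst i α) (fun j => hα _)
    (p := dropFirst i p) fun m h1 h2 =>
      AvoidsPoles.dropFirst hpi (by omega) (hp (i + m) (by omega) (by omega) (by omega))
  exact ⟨_, hasValueAt_linForm_mul_zeta hα hi1 hi hpi hp hw, hw.comp_dropFirst.mul
    (.of_analyticAt (analyticAt_residueMatrix α hi
      (fun d h1 h2 => hp d h1 (by omega) (by omega)) k))⟩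

end Residues

end MHZ

end

theorem theorem6 (r : ℕ) (hr : 1 ≤ r) (α : Fin r → ℝ) (hα : ∀ j, 0 ≤ α j ∧ α j < 1) :
    MHZ.IsMeromorphicContinuation α (MHZ.zeta α) ∧
    MHZ.ResidueEq 1 0 (MHZ.zeta α)
      (fun s => MHZ.zeta (MHZ.dropFirst 1 α) (MHZ.dropFirst 1 s)) ∧
    ∀ (i k : ℕ) (_ : 2 ≤ i) (hi : i ≤ r),
      MHZ.ResidueEq i k (MHZ.zeta α)
        (fun s => MHZ.zeta (MHZ.dropFirst i α) (MHZ.dropFirst i s) *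
          MHZ.residueMatrix α i hi s 0 k) := by
  refine ⟨MHZ.isMeromorphicContinuation_zeta_of_mem_Ico hα, ?_,
    fun i k hi2 hi => MHZ.residueEq_zeta hα (by omega) hi⟩
  have h := MHZ.residueEq_zeta hα (i := 1) (k := 0) le_rfl hr
  have h1 : ∀ s, MHZ.residueMatrix α 1 hr s = 1 := fun s => rfl
  simpa [h1] using h
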